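/- **Notation.** Fix $\tau$ with $\operatorname{Im}\tau>0$ and write $p^{\lambda}=e^{\pi i\tau\lambda}$, $\theta(x;q)=\prod_{j\ge 0}(1-xq^j)(1-q^{j+1}/x)$ and $\theta(x_1,\dots,x_m;q)=\theta(x_1;q)\cdots\theta(x_m;q)$. For a skew-symmetric matrix of size $2n$, $\operatorname{pf}(a_{ij})=\frac1{2^nn!}\sum_{\pi\in S_{2n}}\operatorname{sgn}(\pi)\prod_{j=1}^n a_{\pi(2j-1)\pi(2j)}$. Let $\Sigma=\{0,1,2,3,4,6,\hat 0,\hat 1,\hat 2,\hat 3,\hat 4,\hat 6\}$. For $x_j=e^{\pi i z_j}$ put $$P_n^{(\sigma)}(z_1,\dots,z_{2n};\tau)=\prod_{1\le i<j\le 2n}b_\sigma(x_i/x_j)\ \operatorname{pf}_{1\le i,j\le 2n}\left(\frac{a_\sigma(x_i/x_j)}{b_\sigma(x_i/x_j)}\right),$$ where for the labels without a hat $$a_\sigma(r)=\begin{cases} r^{-2}\,\theta(r^2,-r^2,p\,r^2;p^2), & \sigma=0,1,3,4,\\ r^{-1}\,\theta(r^2,p\,r^2,-p\,r^2;p^2),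 & \sigma=2,6,\end{cases}\qquad b_\sigma(r)=\begin{cases}\theta(p^{1/3}r^2;p^{2/3}), & \sigma=0,6,\\ r^{-3}\,\theta(-r^6;p^6), & \sigma=1,\\ \theta(p^3r^6;p^6), & \sigma=2,4,\\ r^{-1}\,\theta(-r^2;p^{2/3}), & \sigma=3,\end{cases}$$ and $a_{\hat\sigma},b_{\hat\sigma}$ are obtained from $a_\sigma,b_\sigma$ by replacing every factor of the form $\theta(\pm p^\lambda r^k;p^{2\lambda})$ with $\theta(\mp p^\lambda r^k;p^{2\lambda})$. Since $b_\sigma(1/r)=b_\sigma(r)$, the denominators cancel term by term against the product, and $P_n^{(\sigma)}$ is understood as the resulting entire function of $z_1,\dots,z_{2n}$. **Proposition.** Let $n$ be a positive integer, $\sigma\in\Sigma$ and $\operatorname{Im}\tau>0$. Let $z_2,\dots,z_{2n}$ be generic complex numbers (that is, the following holds for all $(z_2,\dots,z_{2n})\in\mathbb C^{2n-1}$ outside the zero set of some entire function on $\mathbb C^{2n-1}$, depending only on $n,\sigma,\tau$, that is not identically zero), and let $t=e^{2\pi i(z_2+\dots+z_{2n})}$. Suppose that $f$ is an entire function such that,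 for all $z\in\mathbb C$, $$f(z+1)=\begin{cases} f(z), & \sigma=0,\hat 0,1,\hat 1,3,\hat 3,4,\hat 4,\\ -f(z), & \sigma=2,\hat 2,6,\hat 6,\end{cases}$$ $$f(z+\tau)=\frac{t^3}{e^{(6n-3)\pi i(2z+\tau)}}\times\begin{cases} f(z), & \sigma=0,1,2,\hat 2,3,4,6,\hat 6,\\ -f(z), & \sigma=\hat 0,\hat 1,\hat 3,\hat 4,\end{cases}$$ $$f\left(z-\tfrac23\right)+f(z)+f\left(z+\tfrac23\right)=0\qquad\text{if }\sigma=1,\hat 1,2,\hat 2,4,\hat 4,$$ $$t^2e^{-(8n-4)\pi i z}f\left(z-\tfrac{2\tau}3\right)+e^{-\frac{(8n-4)\pi i\tau}3}f(z)+t^{-2}e^{(8n-4)\pi i z}f\left(z+\tfrac{2\tau}3\right)=0\qquad\text{if }\sigma=0,\hat 0,3,\hat 3,6,\hat 6,$$ and such that, for all $2\le j\le 2n$, $f(z_j)=0$ and $$\begin{aligned} f\left(z_j+\tfrac12\right)&=0 &&\text{if }\sigma=1,\hat 1,3,\hat 3,\\ f\left(z_j+\tfrac\tau2\right)&=0&&\text{if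 }\sigma=0,2,4,6,\\ f\left(z_j+\tfrac{1+\tau}2\right)&=0&&\text{if }\sigma=\hat 0,\hat 2,\hat 4,\hat 6.\end{aligned}$$ Then there is a constant $C\in\mathbb C$, independent of $z$, such that $f(z)=C\,P_n^{(\sigma)}(z,z_2,\dots,z_{2n};\tau)$ for all $z\in\mathbb C$. -/

import Mathlib

open scoped BigOperators

noncomputable section

namespace EllipticPfaffian

/-- The twelve labels `0, 1, 2, 3, 4, 6` (here `s0, …, s6`) and
`0̂, 1̂, 2̂, 3̂, 4̂, 6̂` (here `h0, …, h6`). -/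
inductive Label
  | s0 | s1 | s2 | s3 | s4 | s6
  | h0 | h1 | h2 | h3 | h4 | h6

/-- `1` for the labels without a hat and `-1` for the labels with a hat. -/
def Label.hatSign : Label → ℂ
  | .s0 | .s1 | .s2 | .s3 | .s4 | .s6 => 1
  | .h0 | .h1 | .h2 | .h3 | .h4 | .h6 => -1

/-- The infinite product `(a; q)_∞ = ∏_{j ≥ 0} (1 - a q ^ j)`, for `|q| < 1`. -/
def qInf (a q : ℂ) : ℂ := ∏' j : ℕ, (1 - a * q ^ j)

/-- The theta function `θ(x; q) = (x; q)_∞ (q / x; q)_∞`. -/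
def theta (x q : ℂ) : ℂ := qInf x q * qInf (q / x) q

/-- The power `p ^ c = exp (π i τ c)` of the nome `p = exp (π i τ)`. -/
def nome (τ c : ℂ) : ℂ := Complex.exp (Real.pi * Complex.I * τ * c)

/-- The pfaffian of a (skew-symmetric) matrix of size `2 n`. -/
def pfaffian (n : ℕ) (A : Fin (2 * n) → Fin (2 * n) → ℂ) : ℂ :=
  1 / (2 ^ n * (n.factorial : ℂ)) *
    ∑ π : Equiv.Perm (Fin (2 * n)), (Equiv.Perm.sign π : ℂ) *
      ∏ k : Fin n, A (π ⟨2 * k, by omega⟩) (π ⟨2 * k + 1, by omega⟩)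

/-- The factor attached to a pair `i < j` in the product in front of the pfaffian, as a function
of `r = x_i / x_j`. In the hatted cases, `θ(± p ^ c r ^ k; p ^ (2 c))` (with `c ≠ 0`) is replaced by
`θ(∓ p ^ c r ^ k; p ^ (2 c))`. -/
def prefactor (σ : Label) (τ r : ℂ) : ℂ :=
  match σ with
  | .s0 | .h0 | .s6 | .h6 => theta (σ.hatSign * nome τ (1 / 3) * r ^ 2) (nome τ (2 / 3))
  | .s1 | .h1 => r⁻¹ ^ 3 * theta (-r ^ 6) (nome τ 6)
  | .s2 | .h2 | .s4 | .h4 => theta (σ.hatSign * nome τ 3 * r ^ 6) (nome τ 6)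
  | .s3 | .h3 => r⁻¹ * theta (-r ^ 2) (nome τ (2 / 3))

/-- The product `θ(r², -r², p r²; p²)` for `σ = 0, 1, 3, 4`, the product `θ(r², -r², -p r²; p²)` for
`σ = 0̂, 1̂, 3̂, 4̂` and the product `θ(r², p r², -p r²; p²)` for `σ = 2, 2̂, 6, 6̂`. -/
def tripleTheta (σ : Label) (τ r : ℂ) : ℂ :=
  match σ with
  | .s0 | .h0 | .s1 | .h1 | .s3 | .h3 | .s4 | .h4 =>
      theta (r ^ 2) (nome τ 2) * theta (-r ^ 2) (nome τ 2) *
        theta (σ.hatSign * nome τ 1 * r ^ 2) (nome τ 2)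
  | .s2 | .h2 | .s6 | .h6 =>
      theta (r ^ 2) (nome τ 2) * theta (nome τ 1 * r ^ 2) (nome τ 2) *
        theta (-nome τ 1 * r ^ 2) (nome τ 2)

/-- The entry in position `(i, j)` of the matrix whose pfaffian is taken, as a function of
`r = x_i / x_j`. It is a meromorphic function; the values at its poles are irrelevant. -/
def entry (σ : Label) (τ r : ℂ) : ℂ :=
  match σ with
  | .s0 | .h0 => r⁻¹ ^ 2 * tripleTheta σ τ r /
      theta (σ.hatSign * nome τ (1 / 3) * r ^ 2) (nome τ (2 / 3))
  | .s1 | .h1 => r * tripleTheta σ τ r / theta (-r ^ 6) (nome τ 6)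
  | .s2 | .h2 => r⁻¹ * tripleTheta σ τ r / theta (σ.hatSign * nome τ 3 * r ^ 6) (nome τ 6)
  | .s3 | .h3 => r⁻¹ * tripleTheta σ τ r / theta (-r ^ 2) (nome τ (2 / 3))
  | .s4 | .h4 => r⁻¹ ^ 2 * tripleTheta σ τ r / theta (σ.hatSign * nome τ 3 * r ^ 6) (nome τ 6)
  | .s6 | .h6 => r⁻¹ * tripleTheta σ τ r /
      theta (σ.hatSign * nome τ (1 / 3) * r ^ 2) (nome τ (2 / 3))

/-- The holomorphic numerator of the entry: `entry = numerator / prefactor`. -/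
def numerator (σ : Label) (τ r : ℂ) : ℂ :=
  match σ with
  | .s0 | .h0 | .s1 | .h1 | .s3 | .h3 | .s4 | .h4 => r⁻¹ ^ 2 * tripleTheta σ τ r
  | .s2 | .h2 | .s6 | .h6 => r⁻¹ * tripleTheta σ τ r

/-- The ratio `x_i / x_j`, where `x_j = exp (π i z_j)`. -/
def xRatio {m : ℕ} (z : Fin m → ℂ) (i j : Fin m) : ℂ :=
  Complex.exp (Real.pi * Complex.I * z i) / Complex.exp (Real.pi * Complex.I * z j)

/-- The pairs `i < j` for which `{i, j}` is none of the sets `{π (2 k), π (2 k + 1)}`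
(numbering from `0`), that is, which are not matched by the pairing attached to `π`. -/
def unmatched (n : ℕ) (π : Equiv.Perm (Fin (2 * n))) : Finset (Fin (2 * n) × Fin (2 * n)) :=
  {q | q.1 < q.2 ∧ ∀ k : Fin n,
    q ≠ (π ⟨2 * k, by omega⟩, π ⟨2 * k + 1, by omega⟩) ∧
    q ≠ (π ⟨2 * k + 1, by omega⟩, π ⟨2 * k, by omega⟩)}

/-- The elliptic pfaffian `P_n^{(σ)}(z_1, …, z_{2n}; τ)`, as an entire function of the variables:
the product over `i < j` of the prefactors times the pfaffian of the matrix of entries,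
with the denominators of the entries cancelled term by term against the product. By
`P_eq_prod_mul_pfaffian` below it is the product times the pfaffian
wherever no entry has a pole. -/
def P (n : ℕ) (σ : Label) (z : Fin (2 * n) → ℂ) (τ : ℂ) : ℂ :=
  1 / (2 ^ n * (n.factorial : ℂ)) *
    ∑ π : Equiv.Perm (Fin (2 * n)), (Equiv.Perm.sign π : ℂ) *
      ((∏ k : Fin n,
          numerator σ τ (xRatio z (π ⟨2 * k, by omega⟩) (π ⟨2 * k + 1, by omega⟩))) *
        ∏ q ∈ unmatched n π, prefactor σ τ (xRatio z q.1 q.2))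

/-! ### The pfaffian formula for `P` -/

theorem norm_nome_lt_one {τ : ℂ} (hτ : 0 < τ.im) {c : ℝ} (hc : 0 < c) : ‖nome τ c‖ < 1 := by
  rw [nome, Complex.norm_exp, Real.exp_lt_one_iff]
  simp
  positivity

theorem qInf_eq_mul (a : ℂ) {q : ℂ} (hq : ‖q‖ < 1) :
    qInf a q = (1 - a) * qInf (q * a) q := by
  have h : Multipliable (fun j : ℕ => 1 - q * a * q ^ j) := by
    have := Complex.multipliable_one_add_of_summable (f := fun j : ℕ => -(q * a * q ^ j))
      ((summable_geometric_of_norm_lt_one hq).mul_left (q * a)).neg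
    simpa [sub_eq_add_neg] using this
  have h' : (fun j : ℕ => 1 - q * a * q ^ j) = fun j : ℕ => 1 - a * q ^ (j + 1) := by
    funext j; ring
  rw [qInf, tprod_eq_zero_mul' (by rw [← h']; exact h), qInf, h']
  simp

theorem theta_inv {x q : ℂ} (hx : x ≠ 0) (hq : ‖q‖ < 1) :
    theta x⁻¹ q = -x⁻¹ * theta x q := by
  have e : q / x⁻¹ = q * x := by field_simp
  have e' : q * x⁻¹ = q / x := by field_simp
  rw [theta, theta, qInf_eq_mul x⁻¹ hq, qInf_eq_mul x hq, e, e']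
  field_simp
  ring

theorem theta_div {x q : ℂ} (hx : x ≠ 0) (hq : q ≠ 0) : theta (q / x) q = theta x q := by
  have e : q / (q / x) = x := by field_simp
  rw [theta, theta, e, mul_comm]

theorem nome_ne_zero (τ c : ℂ) : nome τ c ≠ 0 := Complex.exp_ne_zero _

theorem nome_mul (τ c d : ℂ) : nome τ c * nome τ d = nome τ (c + d) := by
  rw [nome, nome, nome, ← Complex.exp_add]; ring_nf

theorem Label.hatSign_mul_self (σ : Label) : σ.hatSign * σ.hatSign = 1 := by
  cases σ <;> simp [Label.hatSign]

theorem Label.hatSign_ne_zero (σ : Label) : σ.hatSign ≠ 0 := by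
  cases σ <;> simp [Label.hatSign]

theorem theta_half {s u τ c d : ℂ} (hs : s * s = 1) (hu : u ≠ 0) (hd : c + c = d) :
    theta (s * nome τ c * u⁻¹) (nome τ d) = theta (s * nome τ c * u) (nome τ d) := by
  have hs0 : s ≠ 0 := by rintro rfl; simp at hs
  have e : s * nome τ c * u⁻¹ = nome τ d / (s * nome τ c * u) := by
    rw [← hd, ← nome_mul]
    have := nome_ne_zero τ c
    field_simp
    linear_combination hs
  rw [e, theta_div (by have := nome_ne_zero τ c; positivity) (nome_ne_zero _ _)]

theorem prefactor_inv (σ : Label) {τ r : ℂ} (hτ : 0 < τ.im) (hr : r ≠ 0) :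
    prefactor σ τ r⁻¹ = prefactor σ τ r := by
  have h6 : ‖nome τ 6‖ < 1 := by exact_mod_cast norm_nome_lt_one hτ (c := 6) (by norm_num)
  have h23 : ‖nome τ (2 / 3)‖ < 1 := by
    have := norm_nome_lt_one hτ (c := 2 / 3) (by norm_num)
    push_cast at this
    exact this
  have hn6 : -r⁻¹ ^ 6 = (-r ^ 6)⁻¹ := by rw [inv_neg, inv_pow]
  have hn2 : -r⁻¹ ^ 2 = (-r ^ 2)⁻¹ := by rw [inv_neg, inv_pow]
  cases σ <;> simp only [prefactor]
  case s1 | h1 =>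
    rw [hn6, theta_inv (by simpa using hr) h6]; field_simp
  case s3 | h3 =>
    rw [hn2, theta_inv (by simpa using hr) h23]; field_simp
  all_goals
    rw [inv_pow]
    exact theta_half (Label.hatSign_mul_self _) (pow_ne_zero _ hr) (by norm_num)

theorem entry_eq_div (σ : Label) (τ : ℂ) {r : ℂ} (hr : r ≠ 0) :
    entry σ τ r = numerator σ τ r / prefactor σ τ r := by
  cases σ <;> simp only [entry, numerator, prefactor]
  case s1 | h1 =>
    rw [show r * tripleTheta _ τ r = r ^ 3 * (r⁻¹ ^ 2 * tripleTheta _ τ r) by field_simp,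
      inv_pow r 3, div_mul_eq_div_div_swap, div_inv_eq_mul]
    ring
  case s3 | h3 =>
    rw [div_mul_eq_div_div_swap, div_inv_eq_mul]
    field_simp

theorem xRatio_ne_zero {m : ℕ} (z : Fin m → ℂ) (i j : Fin m) : xRatio z i j ≠ 0 :=
  div_ne_zero (Complex.exp_ne_zero _) (Complex.exp_ne_zero _)

theorem xRatio_swap {m : ℕ} (z : Fin m → ℂ) (i j : Fin m) : xRatio z j i = (xRatio z i j)⁻¹ := by
  simp [xRatio]

theorem prod_lt_eq {n : ℕ} (π : Equiv.Perm (Fin (2 * n))) (b : Fin (2 * n) → Fin (2 * n) → ℂ)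
    (hb : ∀ i j, b j i = b i j) :
    ∏ q : Fin (2 * n) × Fin (2 * n) with q.1 < q.2, b q.1 q.2 =
      (∏ k : Fin n, b (π ⟨2 * k, by omega⟩) (π ⟨2 * k + 1, by omega⟩)) *
        ∏ q ∈ unmatched n π, b q.1 q.2 := by
  classical
  have hsub : unmatched n π ⊆ ({q | q.1 < q.2} : Finset (Fin (2 * n) × Fin (2 * n))) := by
    intro q hq
    simp only [unmatched, Finset.mem_filter, Finset.mem_univ, true_and] at hq ⊢
    exact hq.1
  rw [← Finset.prod_sdiff hsub]
  congr 1
  symm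
  let g : Fin n → Fin (2 * n) × Fin (2 * n) := fun k =>
    (min (π ⟨2 * k, by omega⟩) (π ⟨2 * k + 1, by omega⟩),
      max (π ⟨2 * k, by omega⟩) (π ⟨2 * k + 1, by omega⟩))
  have hne : ∀ k : Fin n, π ⟨2 * k, by omega⟩ ≠ π ⟨2 * k + 1, by omega⟩ := by
    intro k h
    have := congrArg Fin.val (π.injective h)
    simp at this
  refine Finset.prod_bij (fun k _ => g k) ?_ ?_ ?_ ?_
  · intro k _
    simp only [unmatched, Finset.mem_sdiff, Finset.mem_filter, Finset.mem_univ, true_and, g]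
    refine ⟨?_, ?_⟩
    · exact min_lt_max.2 (hne k)
    · rintro ⟨-, h⟩
      rcases le_total (π ⟨2 * k, by omega⟩) (π ⟨2 * k + 1, by omega⟩) with hl | hl
      · exact (h k).1 (by rw [min_eq_left hl, max_eq_right hl])
      · exact (h k).2 (by rw [min_eq_right hl, max_eq_left hl])
  · intro k _ l _ h
    simp only [g, Prod.mk.injEq] at h
    obtain ⟨h1, h2⟩ := h
    have : π ⟨2 * k, by omega⟩ = π ⟨2 * l, by omega⟩ ∨
        π ⟨2 * k, by omega⟩ = π ⟨2 * l + 1, by omega⟩ := by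
      grind
    rcases this with h | h <;> have := congrArg Fin.val (π.injective h) <;> simp at this
    · exact Fin.ext this
    · omega
  · intro q hq
    simp only [unmatched, Finset.mem_sdiff, Finset.mem_filter, Finset.mem_univ, true_and,
      not_and, not_forall] at hq
    obtain ⟨hlt, hq⟩ := hq
    obtain ⟨k, hk⟩ := hq hlt
    refine ⟨k, Finset.mem_univ _, ?_⟩
    by_cases h : q = (π ⟨2 * k, by omega⟩, π ⟨2 * k + 1, by omega⟩)
    · have hlt' : π ⟨2 * k, by omega⟩ < π ⟨2 * k + 1, by omega⟩ := by
        have := hlt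
        rw [h] at this
        exact this
      have : g k = (π ⟨2 * k, by omega⟩, π ⟨2 * k + 1, by omega⟩) := by
        simp only [g]
        rw [min_eq_left hlt'.le, max_eq_right hlt'.le]
      exact this.trans h.symm
    · have h' : q = (π ⟨2 * k + 1, by omega⟩, π ⟨2 * k, by omega⟩) := by tauto
      have hlt' : π ⟨2 * k + 1, by omega⟩ < π ⟨2 * k, by omega⟩ := by
        have := hlt
        rw [h'] at this
        exact this
      have : g k = (π ⟨2 * k + 1, by omega⟩, π ⟨2 * k, by omega⟩) := by
        simp only [g]
        rw [min_eq_right hlt'.le, max_eq_left hlt'.le]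
      exact this.trans h'.symm
  · intro k _
    simp only [g]
    rcases le_total (π ⟨2 * k, by omega⟩) (π ⟨2 * k + 1, by omega⟩) with hl | hl
    · rw [min_eq_left hl, max_eq_right hl]
    · rw [min_eq_right hl, max_eq_left hl, hb]

/-- Wherever no entry has a pole, `P` is the product of the prefactors times the pfaffian of the
matrix of entries. -/
theorem P_eq_prod_mul_pfaffian (n : ℕ) (σ : Label) (z : Fin (2 * n) → ℂ) {τ : ℂ} (hτ : 0 < τ.im)
    (hz : ∀ i j, i < j → prefactor σ τ (xRatio z i j) ≠ 0) :
    P n σ z τ =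
      (∏ q : Fin (2 * n) × Fin (2 * n) with q.1 < q.2, prefactor σ τ (xRatio z q.1 q.2)) *
        pfaffian n (fun i j => entry σ τ (xRatio z i j)) := by
  have hsymm : ∀ i j, prefactor σ τ (xRatio z j i) = prefactor σ τ (xRatio z i j) := by
    intro i j
    rw [xRatio_swap, prefactor_inv σ hτ (xRatio_ne_zero z i j)]
  have hz' : ∀ i j, i ≠ j → prefactor σ τ (xRatio z i j) ≠ 0 := by
    intro i j hij
    rcases lt_or_gt_of_ne hij with h | h
    · exact hz i j h
    · rw [hsymm]; exact hz j i h
  rw [P, pfaffian, mul_left_comm (∏ q : Fin (2 * n) × Fin (2 * n) with q.1 < q.2, _)]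
  congr 1
  rw [Finset.mul_sum]
  refine Finset.sum_congr rfl fun π _ => ?_
  rw [mul_left_comm (∏ q : Fin (2 * n) × Fin (2 * n) with q.1 < q.2, _)]
  congr 1
  rw [prod_lt_eq π (fun i j => prefactor σ τ (xRatio z i j)) hsymm, mul_right_comm,
    ← Finset.prod_mul_distrib]
  congr 1
  refine Finset.prod_congr rfl fun k _ => ?_
  rw [entry_eq_div σ τ (xRatio_ne_zero _ _ _), mul_div_cancel₀]
  apply hz'
  intro h
  have := congrArg Fin.val (π.injective h)
  simp at this

/-! ### The analytic conditions -/

/-- The vector `(u, z_2, …, z_{2n})`, where `z_2, …, z_{2n}` are the entries of `z`. -/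
def prepend {n : ℕ} (u : ℂ) (z : Fin (2 * n - 1) → ℂ) : Fin (2 * n) → ℂ :=
  fun i => if h : i.val = 0 then u else z ⟨i.val - 1, by omega⟩

/-- The sign in `f (u + 1) = ± f u`. -/
def periodSign : Label → ℂ
  | .s0 | .h0 | .s1 | .h1 | .s3 | .h3 | .s4 | .h4 => 1
  | .s2 | .h2 | .s6 | .h6 => -1

/-- The sign in the quasi-periodicity under `u ↦ u + τ`. -/
def quasiPeriodSign : Label → ℂ
  | .s0 | .s1 | .s2 | .h2 | .s3 | .s4 | .s6 | .h6 => 1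
  | .h0 | .h1 | .h3 | .h4 => -1

/-- The half-period by which the additional zeros are shifted. -/
def halfPeriod (τ : ℂ) : Label → ℂ
  | .s1 | .h1 | .s3 | .h3 => 1 / 2
  | .s0 | .s2 | .s4 | .s6 => τ / 2
  | .h0 | .h2 | .h4 | .h6 => (1 + τ) / 2

/-- The three-term relation. -/
def ThreeTerm (n : ℕ) (σ : Label) (τ t : ℂ) (f : ℂ → ℂ) : Prop :=
  match σ with
  | .s1 | .h1 | .s2 | .h2 | .s4 | .h4 =>
      ∀ u : ℂ, f (u - 2 / 3) + f u + f (u + 2 / 3) = 0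
  | .s0 | .h0 | .s3 | .h3 | .s6 | .h6 =>
      ∀ u : ℂ,
        t ^ 2 * Complex.exp (-((8 * n - 4) * Real.pi * Complex.I * u)) * f (u - 2 * τ / 3) +
          Complex.exp (-((8 * n - 4) * Real.pi * Complex.I * τ / 3)) * f u +
          (t ^ 2)⁻¹ * Complex.exp ((8 * n - 4) * Real.pi * Complex.I * u) * f (u + 2 * τ / 3) = 0

/-- The conditions imposed on `f`, for the parameters `z = (z_2, …, z_{2n})`. -/
structure IsAdmissible (n : ℕ) (σ : Label) (τ : ℂ) (z : Fin (2 * n - 1) → ℂ) (f : ℂ → ℂ) :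
    Prop where
  entire : Differentiable ℂ f
  add_one : ∀ u, f (u + 1) = periodSign σ * f u
  add_tau : ∀ u, f (u + τ) =
    Complex.exp (2 * Real.pi * Complex.I * ∑ j, z j) ^ 3 /
      Complex.exp ((6 * n - 3) * Real.pi * Complex.I * (2 * u + τ)) * (quasiPeriodSign σ * f u)
  three_term : ThreeTerm n σ τ (Complex.exp (2 * Real.pi * Complex.I * ∑ j, z j)) f
  zero : ∀ j, f (z j) = 0
  zero_half : ∀ j, f (z j + halfPeriod τ σ) = 0

/-- A property of points of `ℂ ^ m` holds for generic points if it holds off the zero set of some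
entire function of `m` variables that is not identically zero. -/
def HoldsGenerically {m : ℕ} (Q : (Fin m → ℂ) → Prop) : Prop :=
  ∃ G : (Fin m → ℂ) → ℂ, Differentiable ℂ G ∧ (∃ z, G z ≠ 0) ∧ ∀ z, G z ≠ 0 → Q z

end EllipticPfaffian

end

/-!
# Uniqueness of the elliptic pfaffians

The conditions on `f` say that `f` is a theta function of degree `6 n - 3`, satisfying a three-term
relation, with `4 n - 2` prescribed zeros. The argument has three steps.

*Reduction to one shift.* The modular transformation `τ ↦ -1/τ` (`modularTransform`) turns the
three-term relation for the shift `2 τ / 3` into the one for the shift `2 / 3`, interchanges the two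
characters of a theta function, and multiplies the pfaffian by an exponential
(`pairingSum_modularTransform`). Thus, all labels lead to a pair of entire functions `A`, `B` with
the few properties collected in `ThetaPair`; these are all that is used afterwards. Theta functions
are handled through Liouville's theorem only: a theta function that vanishes at the simple zeros of
another one of the same degree is proportional to it (`IsTheta.eq_const_mul`). The reference
function is `oddTheta`, whose zeros are read off the infinite product. For example, the three-term
relation for `A` follows since the sum of its three translates is odd, so that it is a multiple of
`oddTheta`, while the characters do not match (`ThetaPair.three_term_A`).

*The pfaffian satisfies the conditions.* As a function of its first variable, each term of the
pfaffian is a constant times `A (u - z j) * ∏ B (u - z k)` with `k` ranging over the indices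
different from `j`, where `j` is the partner of the first index
(`exists_pairingTerm_prepend_eq`). This gives everything except the zeros at `z j`, which come from
antisymmetry. The pfaffian is not identically zero: if the differences within the standard pairs are
zeros of `B`, then only the standard pairing contributes (`pairingSum_ne_zero`).

*Generic uniqueness.* After a translation by the mean of the `z j`, the space of theta functions
with the three-term relation does not depend on `z`. At a special point, whose coordinates come in
pairs with difference `2 / 3` except for a last coordinate `w`, a function in this space that
satisfies the conditions and vanishes in addition at `w + 2 / 3` is a constant multiple of an
explicit product with period `2 / 3`, and the three-term relation forces it to be zero
(`ThetaPair.eq_zero_of_specialPoint`). In particular, the space is finite-dimensional, and the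
uniqueness at the special point persists where a certain determinant, entire in `z`, does not vanish
(`exists_entire_of_eval_injective`). Where in addition the pfaffian does not vanish at the chosen
point `u₀ = w + 2 / 3`, subtracting from `f` the multiple of the pfaffian with the same value at
`u₀` leaves zero.
-/

namespace EllipticPfaffian

open Complex Filter Topology

/-! ### Zeros of the theta function -/

theorem differentiable_qInf {q : ℂ} (hq : ‖q‖ < 1) : Differentiable ℂ (fun a => qInf a q) := by
  intro a
  have hs : Summable (fun j : ℕ => (‖a‖ + 1) * ‖q‖ ^ j) :=
    (summable_geometric_of_lt_one (norm_nonneg _) hq).mul_left _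
  have h := Summable.hasProdLocallyUniformlyOn_nat_one_add (K := Metric.ball (0 : ℂ) (‖a‖ + 1))
    (f := fun (j : ℕ) (x : ℂ) => -(x * q ^ j)) Metric.isOpen_ball hs
    (.of_forall fun j x hx => by
      rw [norm_neg, norm_mul, norm_pow]
      gcongr
      simpa using (mem_ball_zero_iff.1 hx).le)
    (fun j => by fun_prop)
  have hd := h.differentiableOn
    (.of_forall fun s => by
      simpa [Finset.prod_fn] using DifferentiableOn.finsetProd (fun _ _ => by fun_prop))
    Metric.isOpen_ball
  have := hd.differentiableAt (x := a) (Metric.isOpen_ball.mem_nhds (by simp))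
  simpa [qInf, sub_eq_add_neg] using this

theorem qInf_ne_zero {a q : ℂ} (hq : ‖q‖ < 1) (h : ∀ j : ℕ, a * q ^ j ≠ 1) : qInf a q ≠ 0 := by
  have := tprod_one_add_ne_zero_of_summable (f := fun j : ℕ => -(a * q ^ j))
    (fun j => by simpa [← sub_eq_add_neg, sub_eq_zero] using (h j).symm)
    (by simpa using (summable_geometric_of_lt_one (norm_nonneg _) hq).mul_left ‖a‖)
  simpa [qInf, sub_eq_add_neg] using this

/-- The zeros of `θ(x; q)` are the integer powers of `q`. -/
theorem exists_zpow_of_theta_eq_zero {x q : ℂ} (hx : x ≠ 0) (hq : ‖q‖ < 1)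
    (h : theta x q = 0) : ∃ k : ℤ, x = q ^ k := by
  by_contra! hne
  refine mul_ne_zero (qInf_ne_zero hq fun j hj => ?_) (qInf_ne_zero hq fun j hj => ?_) h
  · apply hne (-(j : ℤ))
    rw [zpow_neg, zpow_natCast]
    exact eq_inv_of_mul_eq_one_left hj
  · apply hne (j + 1 : ℕ)
    rw [zpow_natCast, pow_succ]
    field_simp at hj
    linear_combination -hj

theorem theta_mul_left {x q : ℂ} (hx : x ≠ 0) (hq0 : q ≠ 0) (hq : ‖q‖ < 1) :
    theta (q * x) q = -x⁻¹ * theta x q := by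
  have e : q / (q * x) = x⁻¹ := by field_simp
  have e' : q * x⁻¹ = q / x := by field_simp
  rw [theta, theta, qInf_eq_mul x hq, e, qInf_eq_mul x⁻¹ hq, e']
  field_simp
  ring

theorem theta_one {q : ℂ} (hq : ‖q‖ < 1) : theta 1 q = 0 := by
  rw [theta, qInf_eq_mul 1 hq]; simp

theorem theta_self {q : ℂ} (hq0 : q ≠ 0) (hq : ‖q‖ < 1) : theta q q = 0 := by
  rw [theta, div_self hq0, qInf_eq_mul 1 hq]; simp

theorem differentiable_theta_comp {q : ℂ} (hq : ‖q‖ < 1) {g : ℂ → ℂ} (hg : Differentiable ℂ g)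
    (h0 : ∀ v, g v ≠ 0) : Differentiable ℂ (fun v => theta (g v) q) :=
  ((differentiable_qInf hq).comp hg).mul
    ((differentiable_qInf hq).comp ((differentiable_const q).div hg h0))

/-! ### Entire functions with prescribed zeros -/

/-- If all zeros of `G` are simple and are zeros of `F`, then `G` divides `F`. -/
theorem exists_entire_eq_mul {F G : ℂ → ℂ} (hF : Differentiable ℂ F) (hG : Differentiable ℂ G)
    (hs : ∀ v, G v = 0 → deriv G v ≠ 0) (hz : ∀ v, G v = 0 → F v = 0) :
    ∃ H : ℂ → ℂ, Differentiable ℂ H ∧ ∀ v, F v = G v * H v := by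
  classical
  refine ⟨fun v => if G v = 0 then deriv F v / deriv G v else F v / G v, ?_, ?_⟩
  · intro v
    by_cases hv : G v = 0
    · -- near a zero `v` of `G`, the quotient is that of the divided differences at `v`
      have hdF : DifferentiableAt ℂ (dslope F v) v :=
        (((Complex.differentiableOn_dslope (s := Set.univ) univ_mem).2 hF.differentiableOn) v
          trivial).differentiableAt univ_mem
      have hdG : DifferentiableAt ℂ (dslope G v) v :=
        (((Complex.differentiableOn_dslope (s := Set.univ) univ_mem).2 hG.differentiableOn) v
          trivial).differentiableAt univ_mem
      have hne : dslope G v v ≠ 0 := by simpa using hs v hv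
      refine (hdF.div hdG hne).congr_of_eventuallyEq ?_
      filter_upwards [hdG.continuousAt.eventually_ne hne] with u hu
      by_cases huv : u = v
      · subst huv; simp [hv]
      · have huv' : u - v ≠ 0 := sub_ne_zero.2 huv
        have e1 : dslope F v u = F u / (u - v) := by
          rw [dslope_of_ne _ huv, slope_def_field, hz v hv, sub_zero]
        have e2 : dslope G v u = G u / (u - v) := by
          rw [dslope_of_ne _ huv, slope_def_field, hv, sub_zero]
        have hGu : G u ≠ 0 := by
          intro h; apply hu; rw [e2, h, zero_div]
        simp only [hGu, if_false, Pi.div_apply, e1, e2]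
        field_simp
    · refine ((hF v).div (hG v) hv).congr_of_eventuallyEq ?_
      filter_upwards [(hG v).continuousAt.eventually_ne hv] with u hu
      simp [hu]
  · intro v
    by_cases hv : G v = 0
    · simp [hv, hz v hv]
    · simp only [hv, if_false]; field_simp

/-- An entire function vanishing at the zeros of finitely many entire functions which have only
simple zeros, and no zeros in common, is divisible by their product. -/
theorem exists_entire_eq_prod_mul {ι : Type*} [DecidableEq ι] (s : Finset ι) {F : ℂ → ℂ}
    {G : ι → ℂ → ℂ} (hF : Differentiable ℂ F) (hG : ∀ i ∈ s, Differentiable ℂ (G i))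
    (hs : ∀ i ∈ s, ∀ v, G i v = 0 → deriv (G i) v ≠ 0)
    (hdisj : ∀ i ∈ s, ∀ j ∈ s, i ≠ j → ∀ v, G i v = 0 → G j v ≠ 0)
    (hz : ∀ i ∈ s, ∀ v, G i v = 0 → F v = 0) :
    ∃ H : ℂ → ℂ, Differentiable ℂ H ∧ ∀ v, F v = (∏ i ∈ s, G i v) * H v := by
  induction s using Finset.induction_on with
  | empty => exact ⟨F, hF, by simp⟩
  | insert a s ha ih =>
    obtain ⟨H, hH, hFH⟩ := ih (fun i hi => hG i (Finset.mem_insert_of_mem hi))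
      (fun i hi => hs i (Finset.mem_insert_of_mem hi))
      (fun i hi j hj => hdisj i (Finset.mem_insert_of_mem hi) j (Finset.mem_insert_of_mem hj))
      (fun i hi => hz i (Finset.mem_insert_of_mem hi))
    have ha' := Finset.mem_insert_self a s
    obtain ⟨H', hH', hHH'⟩ := exists_entire_eq_mul hH (hG a ha') (hs a ha') (by
      intro v hv
      have h0 := hz a ha' v hv
      rw [hFH] at h0
      refine (mul_eq_zero.1 h0).resolve_left (Finset.prod_ne_zero_iff.2 fun i hi => ?_)
      exact hdisj a ha' i (Finset.mem_insert_of_mem hi) (by rintro rfl; exact ha hi) v hv)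
    refine ⟨H', hH', fun v => ?_⟩
    rw [Finset.prod_insert ha, hFH, hHH']; ring

/-- Two entire functions of several variables that do not vanish identically are nonzero at some
common point. -/
theorem exists_mul_ne_zero {m : ℕ} {F G : (Fin m → ℂ) → ℂ} (hF : Differentiable ℂ F)
    (hG : Differentiable ℂ G) {x y : Fin m → ℂ} (hx : F x ≠ 0) (hy : G y ≠ 0) :
    ∃ z, F z * G z ≠ 0 := by
  -- restrict to the line through `x` and `y`
  let L : ℂ → (Fin m → ℂ) := fun s => x + s • (y - x)
  have hL : Differentiable ℂ L := by fun_prop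
  have key : ∀ {K : (Fin m → ℂ) → ℂ}, Differentiable ℂ K → ∀ s₀, K (L s₀) ≠ 0 →
      ∀ᶠ s in 𝓝[≠] (0 : ℂ), K (L s) ≠ 0 := by
    intro K hK s₀ h0
    have ha : AnalyticOnNhd ℂ (fun s => K (L s)) Set.univ :=
      (hK.comp hL).differentiableOn.analyticOnNhd isOpen_univ
    rcases (ha 0 trivial).eventually_eq_zero_or_eventually_ne_zero with h | h
    · exact absurd (ha.eqOn_zero_of_preconnected_of_eventuallyEq_zero isPreconnected_univ
        trivial h (Set.mem_univ s₀)) h0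
    · exact h
  obtain ⟨s, hs⟩ := ((key hF 0 (by simpa [L] using hx)).and
    (key hG 1 (by simpa [L] using hy))).exists
  exact ⟨L s, mul_ne_zero hs.1 hs.2⟩

/-! ### Theta functions of higher degree -/

/-- Theta functions of degree `N` for the lattice `ℤ + τ ℤ`, with characters `c₁`, `c₂`. If `f` is
not identically zero, then `N` is the number of its zeros in a fundamental parallelogram, and the
center `S` is the sum of these zeros, modulo the lattice and up to a constant that depends only on
`τ`, `N` and the characters. The degree is a complex number to avoid casts. -/
structure IsTheta (τ c₁ c₂ N S : ℂ) (f : ℂ → ℂ) : Prop where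
  entire : Differentiable ℂ f
  add_one : ∀ u, f (u + 1) = c₁ * f u
  add_tau : ∀ u, f (u + τ) = c₂ * exp (-(Real.pi * I * (N * (2 * u + τ) - 2 * S))) * f u

namespace IsTheta

variable {τ c₁ c₂ d₁ d₂ N N' S S' : ℂ} {f g : ℂ → ℂ}

theorem add (hf : IsTheta τ c₁ c₂ N S f) (hg : IsTheta τ c₁ c₂ N S g) :
    IsTheta τ c₁ c₂ N S (fun u => f u + g u) where
  entire := hf.entire.add hg.entire
  add_one u := by rw [hf.add_one, hg.add_one]; ring
  add_tau u := by rw [hf.add_tau, hg.add_tau]; ring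

theorem const_mul (c : ℂ) (hf : IsTheta τ c₁ c₂ N S f) :
    IsTheta τ c₁ c₂ N S (fun u => c * f u) where
  entire := hf.entire.const_mul c
  add_one u := by rw [hf.add_one]; ring
  add_tau u := by rw [hf.add_tau]; ring

theorem mul (hf : IsTheta τ c₁ c₂ N S f) (hg : IsTheta τ d₁ d₂ N' S' g) :
    IsTheta τ (c₁ * d₁) (c₂ * d₂) (N + N') (S + S') (fun u => f u * g u) where
  entire := hf.entire.mul hg.entire
  add_one u := by rw [hf.add_one, hg.add_one]; ring
  add_tau u := by
    rw [hf.add_tau, hg.add_tau,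
      show -(Real.pi * I * ((N + N') * (2 * u + τ) - 2 * (S + S'))) =
        -(Real.pi * I * (N * (2 * u + τ) - 2 * S)) +
          -(Real.pi * I * (N' * (2 * u + τ) - 2 * S')) by ring, exp_add]
    ring

theorem prod {ι : Type*} [DecidableEq ι] (s : Finset ι) {c₁ c₂ N S : ι → ℂ} {f : ι → ℂ → ℂ}
    (hf : ∀ i ∈ s, IsTheta τ (c₁ i) (c₂ i) (N i) (S i) (f i)) :
    IsTheta τ (∏ i ∈ s, c₁ i) (∏ i ∈ s, c₂ i) (∑ i ∈ s, N i) (∑ i ∈ s, S i)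
      (fun u => ∏ i ∈ s, f i u) := by
  induction s using Finset.induction_on with
  | empty => exact ⟨by simp, by simp, by simp⟩
  | insert a s ha ih =>
    simp only [Finset.prod_insert ha, Finset.sum_insert ha]
    exact (hf a (Finset.mem_insert_self a s)).mul
      (ih fun i hi => hf i (Finset.mem_insert_of_mem hi))

theorem comp_sub (hf : IsTheta τ c₁ c₂ N S f) (w : ℂ) :
    IsTheta τ c₁ c₂ N (S + N * w) (fun u => f (u - w)) where
  entire := hf.entire.comp (differentiable_id.sub_const w)
  add_one u := by rw [show u + 1 - w = u - w + 1 by ring, hf.add_one]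
  add_tau u := by
    rw [show u + τ - w = u - w + τ by ring, hf.add_tau]
    congr 3
    ring

theorem add_int_center (k : ℤ) (hf : IsTheta τ c₁ c₂ N S f) : IsTheta τ c₁ c₂ N (S + k) f where
  entire := hf.entire
  add_one := hf.add_one
  add_tau u := by
    rw [hf.add_tau, show -(Real.pi * I * (N * (2 * u + τ) - 2 * (S + k))) =
      -(Real.pi * I * (N * (2 * u + τ) - 2 * S)) + k * (2 * Real.pi * I) by ring, exp_add,
      exp_int_mul_two_pi_mul_I, mul_one]

/-- The zero set of a theta function is invariant under the lattice. -/
theorem zero_add_lattice (hf : IsTheta τ c₁ c₂ N S f) (h₁ : c₁ ≠ 0) (h₂ : c₂ ≠ 0) {u : ℂ}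
    (hu : f u = 0) (k l : ℤ) : f (u + k + l * τ) = 0 := by
  have hone : ∀ v, f (v + 1) = 0 ↔ f v = 0 := fun v => by rw [hf.add_one]; simp [h₁]
  have htau : ∀ v, f (v + τ) = 0 ↔ f v = 0 := fun v => by
    rw [hf.add_tau]; simp [h₂, exp_ne_zero]
  have hk : f (u + k) = 0 := by
    induction k using Int.induction_on with
    | zero => simpa using hu
    | succ i ih => rw [← hone] at ih; rw [← ih]; push_cast; ring_nf
    | pred i ih => rw [← hone]; rw [← ih]; push_cast; ring_nf
  induction l using Int.induction_on with
  | zero => simpa using hk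
  | succ i ih => rw [← htau] at ih; rw [← ih]; push_cast; ring_nf
  | pred i ih => rw [← htau]; rw [← ih]; push_cast; ring_nf

end IsTheta

/-- The ring of entire functions has no zero divisors. -/
theorem eq_zero_of_mul_eq_zero_of_entire {g k : ℂ → ℂ} (hg : Differentiable ℂ g)
    (hk : Differentiable ℂ k) (h : ∀ u, g u * k u = 0) {u₀ : ℂ} (h0 : g u₀ ≠ 0) (u : ℂ) :
    k u = 0 := by
  have ha : AnalyticOnNhd ℂ k Set.univ := hk.differentiableOn.analyticOnNhd isOpen_univ
  refine ha.eqOn_zero_of_preconnected_of_eventuallyEq_zero isPreconnected_univ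
    (Set.mem_univ u₀) ?_ (Set.mem_univ u)
  filter_upwards [(hg u₀).continuousAt.eventually_ne h0] with v hv
  exact (mul_eq_zero.1 (h v)).resolve_left hv

/-- A quotient of theta functions which is entire is a theta function. -/
theorem IsTheta.of_eq_mul {τ c₁ c₂ d₁ d₂ N N' S S' : ℂ} {f g h : ℂ → ℂ}
    (hf : IsTheta τ c₁ c₂ N S f) (hg : IsTheta τ d₁ d₂ N' S' g) (h₁ : d₁ ≠ 0) (h₂ : d₂ ≠ 0)
    {u₀ : ℂ} (h0 : g u₀ ≠ 0) (hh : Differentiable ℂ h) (hfgh : ∀ u, f u = g u * h u) :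
    IsTheta τ (c₁ / d₁) (c₂ / d₂) (N - N') (S - S') h where
  entire := hh
  add_one u := by
    refine sub_eq_zero.1 (eq_zero_of_mul_eq_zero_of_entire
      (k := fun u => h (u + 1) - c₁ / d₁ * h u) hg.entire
      ((hh.comp (differentiable_id.add_const 1)).sub (hh.const_mul _)) (fun v => ?_) h0 u)
    have := hf.add_one v
    rw [hfgh, hfgh, hg.add_one] at this
    field_simp
    linear_combination this
  add_tau u := by
    refine sub_eq_zero.1 (eq_zero_of_mul_eq_zero_of_entire
      (k := fun u => h (u + τ) -
        c₂ / d₂ * exp (-(Real.pi * I * ((N - N') * (2 * u + τ) - 2 * (S - S')))) * h u) hg.entire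
      ((hh.comp (differentiable_id.add_const τ)).sub (by fun_prop)) (fun v => ?_) h0 u)
    have := hf.add_tau v
    rw [hfgh, hfgh, hg.add_tau,
      show -(Real.pi * I * (N * (2 * v + τ) - 2 * S)) =
        -(Real.pi * I * ((N - N') * (2 * v + τ) - 2 * (S - S'))) +
          -(Real.pi * I * (N' * (2 * v + τ) - 2 * S')) by ring, exp_add] at this
    have he := exp_ne_zero (-(Real.pi * I * (N' * (2 * v + τ) - 2 * S')))
    have this' : d₂ * (g v * h (v + τ)) = c₂ *
        exp (-(Real.pi * I * ((N - N') * (2 * v + τ) - 2 * (S - S')))) * (g v * h v) := by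
      apply mul_left_cancel₀ he
      linear_combination this
    generalize exp (-(Real.pi * I * ((N - N') * (2 * v + τ) - 2 * (S - S')))) = X at this' ⊢
    field_simp
    linear_combination this'

/-- Liouville's theorem for theta functions of degree zero: if the characters have modulus one and
the center is real, then the absolute value of `f` is doubly periodic. -/
theorem IsTheta.eq_const {τ c₁ c₂ S : ℂ} (hτ : 0 < τ.im) {f : ℂ → ℂ} (hf : IsTheta τ c₁ c₂ 0 S f)
    (h₁ : ‖c₁‖ = 1) (h₂ : ‖c₂‖ = 1) (hS : S.im = 0) (u : ℂ) : f u = f 0 := by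
  have p1 : Function.Periodic (fun v => ‖f v‖) 1 := fun v => by
    simp only [hf.add_one, norm_mul, h₁, one_mul]
  have p2 : Function.Periodic (fun v => ‖f v‖) τ := fun v => by
    simp only [hf.add_tau, norm_mul, h₂, one_mul, norm_exp]
    simp [hS]
  have hK : IsCompact ((fun x : ℝ × ℝ => (x.1 : ℂ) + x.2 * τ) ''
      (Set.Icc 0 1 ×ˢ Set.Icc 0 1)) :=
    (isCompact_Icc.prod isCompact_Icc).image (by fun_prop)
  obtain ⟨C, hC⟩ := hK.exists_bound_of_continuousOn hf.entire.continuous.continuousOn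
  refine hf.entire.apply_eq_apply_of_bounded ?_ u 0
  refine (Metric.isBounded_closedBall (x := (0 : ℂ)) (r := C)).subset ?_
  rintro _ ⟨v, rfl⟩
  rw [mem_closedBall_zero_iff]
  -- reduce `v = x + y τ` to the fundamental parallelogram
  set y : ℝ := v.im / τ.im
  set x : ℝ := v.re - y * τ.re
  have hv : v = x + y * τ := by
    apply Complex.ext
    · simp [x]
    · simp [y]; field_simp
  have e : ‖f v‖ = ‖f ((Int.fract x : ℝ) + (Int.fract y : ℝ) * τ)‖ := by
    have e1 := p1.int_mul ⌊x⌋ ((Int.fract x : ℝ) + (Int.fract y : ℝ) * τ + ⌊y⌋ * τ)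
    have e2 := p2.int_mul ⌊y⌋ ((Int.fract x : ℝ) + (Int.fract y : ℝ) * τ)
    rw [← e2, ← e1]
    congr 2
    rw [hv, Int.fract, Int.fract]
    push_cast; ring
  rw [e]
  exact hC _ ⟨(Int.fract x, Int.fract y), ⟨⟨Int.fract_nonneg _, (Int.fract_lt_one _).le⟩,
    ⟨Int.fract_nonneg _, (Int.fract_lt_one _).le⟩⟩, rfl⟩

/-- A theta function which vanishes at the zeros of another one of the same degree, all of them
simple, is a constant multiple of it. -/
theorem IsTheta.eq_const_mul {τ c₁ c₂ d₁ d₂ N S S' : ℂ} (hτ : 0 < τ.im) {f g : ℂ → ℂ}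
    (hf : IsTheta τ c₁ c₂ N S f) (hg : IsTheta τ d₁ d₂ N S' g) (hc₁ : ‖c₁‖ = 1) (hc₂ : ‖c₂‖ = 1)
    (hd₁ : ‖d₁‖ = 1) (hd₂ : ‖d₂‖ = 1) (hS : (S - S').im = 0) {u₀ : ℂ} (h0 : g u₀ ≠ 0)
    (hs : ∀ v, g v = 0 → deriv g v ≠ 0) (hz : ∀ v, g v = 0 → f v = 0) :
    ∃ c : ℂ, ∀ u, f u = c * g u := by
  obtain ⟨h, hh, hfgh⟩ := exists_entire_eq_mul hf.entire hg.entire hs hz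
  have ht := hf.of_eq_mul hg (norm_ne_zero_iff.1 (by simp [hd₁]))
    (norm_ne_zero_iff.1 (by simp [hd₂])) h0 hh hfgh
  rw [sub_self] at ht
  have hc := ht.eq_const hτ (by simp [hc₁, hd₁]) (by simp [hc₂, hd₂]) hS
  exact ⟨h 0, fun u => by rw [hfgh, hc u, mul_comm]⟩

/-! ### The odd theta function with zeros at `(1/3) ℤ + τ ℤ` -/

/-- The odd theta function `r⁻³ θ(r⁶; p⁶)`, where `r = exp (π i v)`. -/
noncomputable def oddTheta (τ v : ℂ) : ℂ :=
  exp (-(3 * Real.pi * I * v)) * theta (exp (6 * Real.pi * I * v)) (nome τ 6)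

theorem norm_nome_six_lt_one {τ : ℂ} (hτ : 0 < τ.im) : ‖nome τ 6‖ < 1 := by
  exact_mod_cast norm_nome_lt_one hτ (c := 6) (by norm_num)

theorem differentiable_oddTheta {τ : ℂ} (hτ : 0 < τ.im) : Differentiable ℂ (oddTheta τ) :=
  Differentiable.mul (by fun_prop) (differentiable_theta_comp (norm_nome_six_lt_one hτ)
    (by fun_prop) fun _ => exp_ne_zero _)

theorem oddTheta_add_third (τ v : ℂ) : oddTheta τ (v + 1 / 3) = -oddTheta τ v := by
  rw [oddTheta, oddTheta,
    show -(3 * Real.pi * I * (v + 1 / 3)) = -(3 * Real.pi * I * v) - Real.pi * I by ring,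
    exp_sub_pi_mul_I,
    show 6 * Real.pi * I * (v + 1 / 3) = 6 * Real.pi * I * v + 2 * Real.pi * I by ring,
    exp_add, exp_two_pi_mul_I]
  ring_nf

theorem oddTheta_add_two_thirds (τ v : ℂ) : oddTheta τ (v + 2 / 3) = oddTheta τ v := by
  rw [show v + 2 / 3 = v + 1 / 3 + 1 / 3 by ring, oddTheta_add_third, oddTheta_add_third, neg_neg]

theorem isTheta_oddTheta {τ : ℂ} (hτ : 0 < τ.im) : IsTheta τ (-1) (-1) 3 0 (oddTheta τ) where
  entire := differentiable_oddTheta hτ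
  add_one u := by
    rw [show u + 1 = u + 1 / 3 + 1 / 3 + 1 / 3 by ring]
    simp only [oddTheta_add_third]; ring
  add_tau u := by
    have e : exp (6 * Real.pi * I * (u + τ)) = nome τ 6 * exp (6 * Real.pi * I * u) := by
      rw [nome, ← exp_add]; ring_nf
    rw [oddTheta, oddTheta, e, theta_mul_left (exp_ne_zero _) (nome_ne_zero _ _)
      (norm_nome_six_lt_one hτ), ← exp_neg,
      show -(Real.pi * I * (3 * (2 * u + τ) - 2 * 0)) =
        -(3 * Real.pi * I * τ) + -(6 * Real.pi * I * u) by ring,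
      show -(3 * Real.pi * I * (u + τ)) = -(3 * Real.pi * I * τ) + -(3 * Real.pi * I * u) by ring]
    simp only [exp_add]
    ring

theorem oddTheta_eq_zero_iff {τ : ℂ} (hτ : 0 < τ.im) {v : ℂ} :
    oddTheta τ v = 0 ↔ ∃ k l : ℤ, v = k / 3 + l * τ := by
  constructor
  · intro h
    obtain ⟨l, hl⟩ := exists_zpow_of_theta_eq_zero (exp_ne_zero _) (norm_nome_six_lt_one hτ)
      ((mul_eq_zero.1 h).resolve_left (exp_ne_zero _))
    rw [nome, ← exp_int_mul, exp_eq_exp_iff_exists_int] at hl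
    obtain ⟨k, hk⟩ := hl
    refine ⟨k, l, ?_⟩
    have : (6 * Real.pi * I : ℂ) ≠ 0 := by simp [Real.pi_ne_zero, I_ne_zero]
    apply mul_left_cancel₀ this
    rw [hk]; ring
  · rintro ⟨k, l, rfl⟩
    have h0 : oddTheta τ 0 = 0 := by
      simp [oddTheta, theta_one (norm_nome_six_lt_one hτ)]
    have hk : oddTheta τ (k / 3) = 0 := by
      have hstep : ∀ v, oddTheta τ (v + 1 / 3) = 0 ↔ oddTheta τ v = 0 := fun v => by
        rw [oddTheta_add_third, neg_eq_zero]
      induction k using Int.induction_on with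
      | zero => simpa using h0
      | succ i ih => rw [← hstep] at ih; rw [← ih]; push_cast; ring_nf
      | pred i ih => rw [← hstep]; rw [← ih]; push_cast; ring_nf
    simpa using (isTheta_oddTheta hτ).zero_add_lattice (by simp) (by simp) hk 0 l

theorem deriv_oddTheta_ne_zero {τ : ℂ} (hτ : 0 < τ.im) {v : ℂ} (hv : oddTheta τ v = 0) :
    deriv (oddTheta τ) v ≠ 0 := by
  have hq := norm_nome_six_lt_one hτ
  have hd := differentiable_oddTheta hτ
  -- at the origin, split off the factor `1 - r⁶` from the infinite product
  have h0 : deriv (oddTheta τ) 0 ≠ 0 := by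
    let R : ℂ → ℂ := fun v => exp (-(3 * Real.pi * I * v)) *
      (qInf (nome τ 6 * exp (6 * Real.pi * I * v)) (nome τ 6) *
        qInf (nome τ 6 / exp (6 * Real.pi * I * v)) (nome τ 6))
    have hR : Differentiable ℂ R := by
      refine Differentiable.mul (by fun_prop) (Differentiable.mul ?_ ?_)
      · exact (differentiable_qInf hq).comp (by fun_prop)
      · exact (differentiable_qInf hq).comp
          ((differentiable_const _).div (by fun_prop) fun _ => exp_ne_zero _)
    have hO : oddTheta τ = fun v => (1 - exp (6 * Real.pi * I * v)) * R v := by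
      funext v
      rw [oddTheta, theta, qInf_eq_mul _ hq]; simp only [R]; ring
    have h1 : HasDerivAt (fun v : ℂ => 1 - exp (6 * Real.pi * I * v)) (-(6 * Real.pi * I)) 0 := by
      have := ((((hasDerivAt_id (0 : ℂ)).const_mul (6 * Real.pi * I)).cexp).const_sub 1)
      simpa using this
    have := (h1.mul (hR 0).hasDerivAt).deriv
    have hO' : deriv (oddTheta τ) 0 = -(6 * Real.pi * I) * R 0 := by
      rw [hO]
      refine Eq.trans this ?_
      simp
    rw [hO']
    have hne : qInf (nome τ 6) (nome τ 6) ≠ 0 := by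
      refine qInf_ne_zero hq fun j hj => ?_
      have := congrArg norm hj
      rw [← pow_succ', norm_pow, norm_one] at this
      exact absurd this (pow_lt_one₀ (norm_nonneg _) hq (by simp)).ne
    have : R 0 ≠ 0 := by simpa [R] using hne
    simp [Real.pi_ne_zero, I_ne_zero, this]
  have hthird : ∀ v, deriv (oddTheta τ) (v + 1 / 3) ≠ 0 ↔ deriv (oddTheta τ) v ≠ 0 := fun v => by
    rw [← deriv_comp_add_const, show (fun x => oddTheta τ (x + 1 / 3)) = -oddTheta τ from
      funext fun x => oddTheta_add_third τ x, deriv.neg, neg_ne_zero]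
  have htau : ∀ v, oddTheta τ v = 0 →
      (deriv (oddTheta τ) (v + τ) ≠ 0 ↔ deriv (oddTheta τ) v ≠ 0) := fun v hv => by
    let E : ℂ → ℂ := fun u => (-1) * exp (-(Real.pi * I * (3 * (2 * u + τ) - 2 * 0)))
    have hE : Differentiable ℂ E := by fun_prop
    have e : (fun x => oddTheta τ (x + τ)) = E * oddTheta τ :=
      funext fun x => (isTheta_oddTheta hτ).add_tau x
    rw [← deriv_comp_add_const, e, deriv_mul (hE v) (hd v), hv, mul_zero, zero_add]
    simp [E, exp_ne_zero]
  -- move to the other zeros by quasi-periodicity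
  obtain ⟨k, l, rfl⟩ := (oddTheta_eq_zero_iff hτ).1 hv
  have hk : deriv (oddTheta τ) (k / 3) ≠ 0 := by
    clear hv
    induction k using Int.induction_on with
    | zero => simpa using h0
    | succ i ih => rw [← hthird] at ih; convert ih using 2; push_cast; ring
    | pred i ih => rw [← hthird]; convert ih using 2; push_cast; ring
  have hz : ∀ l : ℤ, oddTheta τ (k / 3 + l * τ) = 0 := fun l =>
    (oddTheta_eq_zero_iff hτ).2 ⟨k, l, rfl⟩
  clear hv
  induction l using Int.induction_on with
  | zero => simpa using hk
  | succ i ih => rw [← htau _ (hz _)] at ih; convert ih using 2; push_cast; ring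
  | pred i ih => rw [← htau _ (hz _)]; convert ih using 2; push_cast; ring

theorem exists_oddTheta_ne_zero {τ : ℂ} (hτ : 0 < τ.im) : ∃ v, oddTheta τ v ≠ 0 := by
  by_contra! h
  refine deriv_oddTheta_ne_zero hτ (h 0) ?_
  rw [show oddTheta τ = fun _ => 0 from funext h, deriv_const]

/-! ### The three-term relation and the pair of functions behind the pfaffian -/

/-- The three-term relation for the shift `2 / 3`. -/
def ThreeTermThird (f : ℂ → ℂ) : Prop := ∀ u, f (u - 2 / 3) + f u + f (u + 2 / 3) = 0

/-- A theta function satisfying the three-term relation that vanishes at `w` and `w + 2/3` vanishes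
at all zeros of `oddTheta τ (· - w)`. -/
theorem ThreeTermThird.zero_of_oddTheta_eq_zero {τ c₁ c₂ N S : ℂ} (hτ : 0 < τ.im) {f : ℂ → ℂ}
    (h3 : ThreeTermThird f) (hf : IsTheta τ c₁ c₂ N S f) (h₁ : c₁ ≠ 0) (h₂ : c₂ ≠ 0) {w v : ℂ}
    (hw : f w = 0) (hw' : f (w + 2 / 3) = 0) (hv : oddTheta τ (v - w) = 0) : f v = 0 := by
  obtain ⟨k, l, hkl⟩ := (oddTheta_eq_zero_iff hτ).1 hv
  have hw'' : f (w - 2 / 3) = 0 := by have := h3 w; rw [hw, hw'] at this; simpa using this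
  obtain ⟨j, hj⟩ : ∃ j, k = 3 * j ∨ k = 3 * j + 1 ∨ k = 3 * j + 2 := ⟨k / 3, by omega⟩
  rw [sub_eq_iff_eq_add.1 hkl]
  rcases hj with rfl | rfl | rfl
  · convert hf.zero_add_lattice h₁ h₂ hw j l using 2
    push_cast; ring
  · convert hf.zero_add_lattice h₁ h₂ hw'' (j + 1) l using 2
    push_cast; ring
  · convert hf.zero_add_lattice h₁ h₂ hw' j l using 2
    push_cast; ring

/-- A function with period `2/3` satisfying the three-term relation is zero. -/
theorem ThreeTermThird.eq_zero_of_periodic {f : ℂ → ℂ} (h3 : ThreeTermThird f)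
    (h : ∀ u, f (u + 2 / 3) = f u) (u : ℂ) : f u = 0 := by
  have e1 := h3 u
  have e2 := h (u - 2 / 3)
  rw [sub_add_cancel] at e2
  rw [h, ← e2] at e1
  linear_combination e1 / 3

theorem ThreeTermThird.comp_add {f : ℂ → ℂ} (h3 : ThreeTermThird f) (w : ℂ) :
    ThreeTermThird (fun u => f (u + w)) := fun u => by
  have := h3 (u + w)
  beta_reduce
  rw [show u - 2 / 3 + w = u + w - 2 / 3 by ring, show u + 2 / 3 + w = u + w + 2 / 3 by ring]
  exact this

/-- The properties of the functions `A` and `B` which make the sum over all pairings of products of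
`A (zᵢ - zⱼ)` for the matched and `B (zᵢ - zⱼ)` for the unmatched pairs a theta function of the
first variable that satisfies the three-term relation. Here, `(a + b τ) / 2` is a half-period
where both `A` and `B` vanish. -/
structure ThetaPair (τ α₁ α₂ β₁ β₂ : ℂ) (a b : ℤ) (A B : ℂ → ℂ) : Prop where
  im_pos : 0 < τ.im
  α₁_eq : α₁ = 1 ∨ α₁ = -1
  α₂_eq : α₂ = 1 ∨ α₂ = -1
  β₁_eq : β₁ = 1 ∨ β₁ = -1
  β₂_eq : β₂ = 1 ∨ β₂ = -1
  char_ne : ¬ (α₁ = -1 ∧ α₂ = -1)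
  not_even : ¬ (Even a ∧ Even b)
  isTheta_A : IsTheta τ α₁ α₂ 3 0 A
  odd_A : ∀ v, A (-v) = -A v
  A_half : A ((a + b * τ) / 2) = 0
  A_ne : ∃ v, A v ≠ 0
  isTheta_B : IsTheta τ β₁ β₂ 3 0 B
  B_third : ∀ v, B (v + 1 / 3) = β₁ * B v
  even_B : ∀ v, B (-v) = B v
  B_half : B ((a + b * τ) / 2) = 0
  B_ne : ∃ v, B v ≠ 0

theorem norm_eq_one_of_sign {c : ℂ} (h : c = 1 ∨ c = -1) : ‖c‖ = 1 := by
  rcases h with rfl | rfl <;> simp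

theorem ne_zero_of_sign {c : ℂ} (h : c = 1 ∨ c = -1) : c ≠ 0 := by
  rcases h with rfl | rfl <;> simp

theorem mul_self_of_sign {c : ℂ} (h : c = 1 ∨ c = -1) : c * c = 1 := by
  rcases h with rfl | rfl <;> simp

namespace ThetaPair

variable {τ α₁ α₂ β₁ β₂ : ℂ} {a b : ℤ} {A B : ℂ → ℂ}

theorem B_two_thirds (D : ThetaPair τ α₁ α₂ β₁ β₂ a b A B) (v : ℂ) : B (v + 2 / 3) = B v := by
  rw [show v + 2 / 3 = v + 1 / 3 + 1 / 3 by ring, D.B_third, D.B_third, ← mul_assoc,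
    mul_self_of_sign D.β₁_eq, one_mul]

/-- The sum of the three translates of `A` is odd, so it vanishes at the zeros of `oddTheta`. It
is then a multiple of `oddTheta`, and hence zero, as the characters differ. -/
theorem three_term_A (D : ThetaPair τ α₁ α₂ β₁ β₂ a b A B) : ThreeTermThird A := by
  have hτ := D.im_pos
  let g : ℂ → ℂ := fun v => A (v - 2 / 3) + A v + A (v + 2 / 3)
  have hg : IsTheta τ α₁ α₂ 3 0 g := by
    have h1 := (D.isTheta_A.comp_sub (2 / 3)).add_int_center (-2)
    have h2 := (D.isTheta_A.comp_sub (-(2 / 3))).add_int_center 2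
    have e1 : (0 + 3 * (2 / 3) + ((-2 : ℤ) : ℂ) : ℂ) = 0 := by norm_num
    have e2 : (0 + 3 * (-(2 / 3)) + ((2 : ℤ) : ℂ) : ℂ) = 0 := by norm_num
    rw [e1] at h1
    rw [e2] at h2
    simpa [g] using (h1.add D.isTheta_A).add h2
  have hthird : ∀ v, g (v + 1 / 3) = α₁ * g v := by
    intro v
    have e1 := D.isTheta_A.add_one (v - 1 / 3)
    have e2 := D.isTheta_A.add_one (v - 2 / 3)
    have e3 := D.isTheta_A.add_one v
    simp only [g]
    rw [show v + 1 / 3 - 2 / 3 = v - 1 / 3 by ring, show v + 1 / 3 + 2 / 3 = v + 1 by ring, e3,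
      show v + 1 / 3 = v - 2 / 3 + 1 by ring, e2, show v + 2 / 3 = v - 1 / 3 + 1 by ring, e1]
    linear_combination (-A (v - 1 / 3)) * mul_self_of_sign D.α₁_eq
  have hodd : ∀ v, g (-v) = -g v := by
    intro v
    simp only [g]
    rw [show -v - 2 / 3 = -(v + 2 / 3) by ring, show -v + 2 / 3 = -(v - 2 / 3) by ring]
    simp only [D.odd_A]; ring
  have h0 : g 0 = 0 := by
    have := hodd 0
    rw [neg_zero] at this
    linear_combination this / 2
  have hz : ∀ v, oddTheta τ v = 0 → g v = 0 := by
    intro v hv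
    obtain ⟨k, l, rfl⟩ := (oddTheta_eq_zero_iff hτ).1 hv
    have hk : g (k / 3) = 0 := by
      have hstep : ∀ v, g (v + 1 / 3) = 0 ↔ g v = 0 := fun v => by
        rw [hthird]; simp [ne_zero_of_sign D.α₁_eq]
      clear hv
      induction k using Int.induction_on with
      | zero => simpa using h0
      | succ i ih => rw [← hstep] at ih; rw [← ih]; push_cast; ring_nf
      | pred i ih => rw [← hstep]; rw [← ih]; push_cast; ring_nf
    simpa using hg.zero_add_lattice (ne_zero_of_sign D.α₁_eq) (ne_zero_of_sign D.α₂_eq) hk 0 l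
  obtain ⟨v₀, hv₀⟩ := exists_oddTheta_ne_zero hτ
  obtain ⟨c, hc⟩ := hg.eq_const_mul hτ (isTheta_oddTheta hτ) (norm_eq_one_of_sign D.α₁_eq)
    (norm_eq_one_of_sign D.α₂_eq) (by simp) (by simp) (by simp) hv₀
    (fun v => deriv_oddTheta_ne_zero hτ) hz
  have hc0 : c = 0 := by
    by_contra hne
    refine D.char_ne ⟨?_, ?_⟩
    · have h := hthird v₀
      rw [hc, hc, oddTheta_add_third] at h
      have : c * oddTheta τ v₀ * (α₁ + 1) = 0 := by linear_combination -h
      exact eq_neg_of_add_eq_zero_left ((mul_eq_zero.1 this).resolve_left (mul_ne_zero hne hv₀))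
    · have h := hg.add_tau v₀
      rw [hc, hc, (isTheta_oddTheta hτ).add_tau] at h
      have : c * oddTheta τ v₀ * exp (-(Real.pi * I * (3 * (2 * v₀ + τ) - 2 * 0))) *
        (α₂ + 1) = 0 := by linear_combination -h
      exact eq_neg_of_add_eq_zero_left ((mul_eq_zero.1 this).resolve_left
        (mul_ne_zero (mul_ne_zero hne hv₀) (exp_ne_zero _)))
  intro u
  have := hc u
  rwa [hc0, zero_mul] at this

/-- Up to an exponential factor, `B` is the translate of `oddTheta` by the half-period. -/
theorem exists_B_eq (D : ThetaPair τ α₁ α₂ β₁ β₂ a b A B) :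
    ∃ c : ℂ, c ≠ 0 ∧ ∀ v, B v =
      c * (exp (-(3 * Real.pi * I * b * v)) * oddTheta τ (v - (a + b * τ) / 2)) := by
  have hτ := D.im_pos
  set ω : ℂ := (a + b * τ) / 2
  -- the exponential makes the difference of the centers real, as Liouville's theorem requires
  have he : IsTheta τ (exp (-(3 * Real.pi * I * b))) 1 0 (-(3 * b * τ / 2))
      (fun v => exp (-(3 * Real.pi * I * b * v))) := by
    refine ⟨by fun_prop, fun u => ?_, fun u => ?_⟩
    · rw [← exp_add]; ring_nf
    · rw [one_mul, ← exp_add]; ring_nf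
  have hO := (isTheta_oddTheta hτ).comp_sub ω
  have ht := he.mul hO
  rw [zero_add] at ht
  obtain ⟨v₀, hv₀⟩ := exists_oddTheta_ne_zero hτ
  have hd : Differentiable ℂ (fun v => oddTheta τ (v - ω)) := hO.entire
  suffices h : ∃ c : ℂ, ∀ v, B v =
      c * (exp (-(3 * Real.pi * I * b * v)) * oddTheta τ (v - ω)) by
    obtain ⟨c, hc⟩ := h
    refine ⟨c, ?_, hc⟩
    rintro rfl
    obtain ⟨v, hv⟩ := D.B_ne
    exact hv (by rw [hc, zero_mul])
  refine D.isTheta_B.eq_const_mul hτ ht (norm_eq_one_of_sign D.β₁_eq)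
    (norm_eq_one_of_sign D.β₂_eq) ?_ (by simp) ?_ (u₀ := v₀ + ω) ?_ ?_ ?_
  · rw [norm_mul, norm_exp]; simp
  · simp [ω]; ring
  · rw [add_sub_cancel_right]
    exact mul_ne_zero (exp_ne_zero _) hv₀
  · intro v hv
    have hv' := (mul_eq_zero.1 hv).resolve_left (exp_ne_zero _)
    have hde : Differentiable ℂ (fun v : ℂ => exp (-(3 * Real.pi * I * b * v))) := by fun_prop
    have : deriv (fun v : ℂ => exp (-(3 * Real.pi * I * b * v)) * oddTheta τ (v - ω)) v =
        exp (-(3 * Real.pi * I * b * v)) * deriv (oddTheta τ) (v - ω) := by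
      have h1 := ((hde v).hasDerivAt.mul (hd v).hasDerivAt).deriv
      refine Eq.trans h1 ?_
      rw [hv', mul_zero, zero_add, deriv_comp_sub_const]
    rw [this]
    exact mul_ne_zero (exp_ne_zero _) (deriv_oddTheta_ne_zero hτ hv')
  · intro v hv
    have hv' := (mul_eq_zero.1 hv).resolve_left (exp_ne_zero _)
    obtain ⟨k, l, hkl⟩ := (oddTheta_eq_zero_iff hτ).1 hv'
    rw [sub_eq_iff_eq_add.1 hkl]
    have hk : B (ω + k / 3) = 0 := by
      have hstep : ∀ v, B (v + 1 / 3) = 0 ↔ B v = 0 := fun v => by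
        rw [D.B_third]; simp [ne_zero_of_sign D.β₁_eq]
      clear hkl
      induction k using Int.induction_on with
      | zero => simpa using D.B_half
      | succ i ih => rw [← hstep] at ih; rw [← ih]; push_cast; ring_nf
      | pred i ih => rw [← hstep]; rw [← ih]; push_cast; ring_nf
    convert D.isTheta_B.zero_add_lattice (ne_zero_of_sign D.β₁_eq) (ne_zero_of_sign D.β₂_eq)
      hk 0 l using 2
    push_cast; ring

theorem B_eq_zero_iff (D : ThetaPair τ α₁ α₂ β₁ β₂ a b A B) {v : ℂ} :
    B v = 0 ↔ oddTheta τ (v - (a + b * τ) / 2) = 0 := by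
  obtain ⟨c, hc, hB⟩ := D.exists_B_eq
  simp [hB, hc, exp_ne_zero]

theorem deriv_B_ne_zero (D : ThetaPair τ α₁ α₂ β₁ β₂ a b A B) {v : ℂ} (hv : B v = 0) :
    deriv B v ≠ 0 := by
  obtain ⟨c, hc, hB⟩ := D.exists_B_eq
  have hv' := D.B_eq_zero_iff.1 hv
  have hde : Differentiable ℂ (fun v : ℂ => c * exp (-(3 * Real.pi * I * b * v))) := by fun_prop
  have hd : Differentiable ℂ (fun v : ℂ => oddTheta τ (v - (a + b * τ) / 2)) :=
    ((isTheta_oddTheta D.im_pos).comp_sub _).entire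
  have h1 := ((hde v).hasDerivAt.mul (hd v).hasDerivAt).deriv
  rw [hv', mul_zero, zero_add, deriv_comp_sub_const] at h1
  rw [show B = (fun v : ℂ => c * exp (-(3 * Real.pi * I * b * v))) *
    (fun v : ℂ => oddTheta τ (v - (a + b * τ) / 2)) from
      funext fun v => by rw [hB]; simp only [Pi.mul_apply]; ring, h1]
  exact mul_ne_zero (mul_ne_zero hc (exp_ne_zero _)) (deriv_oddTheta_ne_zero D.im_pos hv')

/-- At the zero `(a + b τ)/2 + 2/3` of `B`, the function `A` does not vanish. -/
theorem A_half_add_ne_zero (D : ThetaPair τ α₁ α₂ β₁ β₂ a b A B) :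
    A ((a + b * τ) / 2 + 2 / 3) ≠ 0 := by
  intro h
  have hτ := D.im_pos
  obtain ⟨v₀, hv₀⟩ := D.B_ne
  obtain ⟨c, hc⟩ := D.isTheta_A.eq_const_mul hτ D.isTheta_B (norm_eq_one_of_sign D.α₁_eq)
    (norm_eq_one_of_sign D.α₂_eq) (norm_eq_one_of_sign D.β₁_eq) (norm_eq_one_of_sign D.β₂_eq)
    (by simp) hv₀ (fun v => D.deriv_B_ne_zero) (fun v hv =>
      D.three_term_A.zero_of_oddTheta_eq_zero hτ D.isTheta_A (ne_zero_of_sign D.α₁_eq)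
        (ne_zero_of_sign D.α₂_eq) D.A_half h (D.B_eq_zero_iff.1 hv))
  obtain ⟨v, hv⟩ := D.A_ne
  exact hv (D.three_term_A.eq_zero_of_periodic (fun u => by rw [hc, hc, D.B_two_thirds]) v)

/-- `oddTheta` and `B` have no common zeros. -/
theorem B_ne_zero_of_oddTheta_eq_zero (D : ThetaPair τ α₁ α₂ β₁ β₂ a b A B) {v : ℂ}
    (hv : oddTheta τ v = 0) : B v ≠ 0 := by
  intro h
  obtain ⟨k, l, hkl⟩ := (oddTheta_eq_zero_iff D.im_pos).1 hv
  obtain ⟨k', l', hkl'⟩ := (oddTheta_eq_zero_iff D.im_pos).1 (D.B_eq_zero_iff.1 h)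
  rw [hkl] at hkl'
  have hi := congrArg Complex.im hkl'
  have hr := congrArg Complex.re hkl'
  simp only [add_im, sub_im, mul_im, div_ofNat_im, intCast_im, intCast_re, add_re, sub_re, mul_re,
    div_ofNat_re] at hi hr
  have hl : (2 * l - b - 2 * l' : ℝ) = 0 := by
    refine (mul_eq_zero.1 ?_).resolve_right D.im_pos.ne'
    linear_combination 2 * hi
  have hk : (2 * k - 3 * a - 2 * k' : ℝ) = 0 := by
    linear_combination 6 * hr - 3 * τ.re * hl
  have hl' : 2 * l - b - 2 * l' = 0 := by exact_mod_cast hl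
  have hk' : 2 * k - 3 * a - 2 * k' = 0 := by exact_mod_cast hk
  exact D.not_even ⟨by rw [Int.even_iff]; omega, by rw [Int.even_iff]; omega⟩

end ThetaPair

/-- Nonzero multiples of `√2` are not in `(1/6) ℤ + (τ/2) ℤ`. -/
theorem int_mul_sqrt_two_ne {τ : ℂ} (hτ : 0 < τ.im) {k : ℤ} (hk : k ≠ 0) (p q : ℤ) :
    (k : ℂ) * (Real.sqrt 2 : ℝ) ≠ p / 6 + q * τ / 2 := by
  intro h
  have hi := congrArg Complex.im h
  have hr := congrArg Complex.re h
  simp only [add_im, mul_im, div_ofNat_im, intCast_im, intCast_re, add_re, mul_re,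
    div_ofNat_re, ofReal_re, ofReal_im] at hi hr
  have hq : (q : ℝ) = 0 := by
    refine (mul_eq_zero.1 ?_).resolve_right hτ.ne'
    linear_combination (-2) * hi
  rw [hq] at hr
  refine (irrational_sqrt_two.intCast_mul hk) ⟨p / 6, ?_⟩
  push_cast
  linear_combination -hr

/-! ### Uniqueness at a special point -/

/-- The base points `k √2` for `i = 2 k` and `i = 2 k + 1`; an irrational factor keeps the
translates of the lattice `(1/6) ℤ + (τ/2) ℤ` by distinct base points disjoint. -/
noncomputable def basePoint (i : ℕ) : ℂ := ((i / 2 : ℕ) : ℂ) * (Real.sqrt 2 : ℝ)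

/-- The special point at which the conditions on `f` are seen to be independent: its coordinates
come in pairs that differ by `2 / 3`, and a single last one. -/
noncomputable def specialPoint (m : ℕ) (i : Fin m) : ℂ :=
  basePoint i + ((i.val % 2 : ℕ) : ℂ) * (2 / 3)

/-- At the special point, the conditions imposed on `f` become the vanishing of `f` at all zeros
of a product of `m` translates of `oddTheta` and `B`; this uses the three-term relation, and one
more zero of `f`, which is paired with the last coordinate. Then `f` is a multiple of that product,
which has period `2/3`, so the three-term relation gives `f = 0`. -/
theorem ThetaPair.eq_zero_of_specialPoint {τ α₁ α₂ β₁ β₂ : ℂ} {a b : ℤ} {A B : ℂ → ℂ}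
    (D : ThetaPair τ α₁ α₂ β₁ β₂ a b A B) {n : ℕ} (hn : 0 < n) {f : ℂ → ℂ}
    (hf : IsTheta τ α₁ α₂ (3 * (2 * n - 1 : ℕ)) (3 * ∑ i, specialPoint (2 * n - 1) i) f)
    (h3 : ThreeTermThird f) (hz : ∀ i, f (specialPoint (2 * n - 1) i) = 0)
    (hz' : ∀ i, f (specialPoint (2 * n - 1) i + (a + b * τ) / 2) = 0)
    (h0 : f (basePoint (2 * n - 2) + 2 / 3) = 0) (u : ℂ) : f u = 0 := by
  have hτ := D.im_pos
  have hα₁ := ne_zero_of_sign D.α₁_eq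
  have hα₂ := ne_zero_of_sign D.α₂_eq
  obtain ⟨m, hm⟩ : ∃ m, m = 2 * n - 1 := ⟨_, rfl⟩
  have hm2 : 2 * n - 2 = m - 1 := by omega
  rw [hm2] at h0
  rw [← hm] at hf hz hz'
  let G : Fin m → ℂ → ℂ := fun i v =>
    if i.val % 2 = 0 then oddTheta τ (v - basePoint i) else B (v - basePoint i)
  have hGe : ∀ i : Fin m, i.val % 2 = 0 → G i = fun v => oddTheta τ (v - basePoint i) :=
    fun i hi => by simp [G, hi]
  have hGo : ∀ i : Fin m, ¬ i.val % 2 = 0 → G i = fun v => B (v - basePoint i) :=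
    fun i hi => by simp only [G, hi, if_false]
  have hG : ∀ i ∈ (Finset.univ : Finset (Fin m)), IsTheta τ (if i.val % 2 = 0 then -1 else β₁)
      (if i.val % 2 = 0 then -1 else β₂) 3 (0 + 3 * basePoint i) (G i) := by
    intro i _
    by_cases hi : i.val % 2 = 0
    · rw [hGe i hi]; simpa only [hi, if_true] using (isTheta_oddTheta hτ).comp_sub (basePoint i)
    · rw [hGo i hi]; simpa only [hi, if_false] using D.isTheta_B.comp_sub (basePoint i)
  have hGp : ∀ i v, G i (v + 2 / 3) = G i v := by
    intro i v
    by_cases hi : i.val % 2 = 0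
    · simp only [hGe i hi]
      rw [show v + 2 / 3 - basePoint i = v - basePoint i + 2 / 3 by ring, oddTheta_add_two_thirds]
    · simp only [hGo i hi]
      rw [show v + 2 / 3 - basePoint i = v - basePoint i + 2 / 3 by ring, D.B_two_thirds]
  have hGs : ∀ i ∈ (Finset.univ : Finset (Fin m)), ∀ v, G i v = 0 → deriv (G i) v ≠ 0 := by
    intro i _ v hv
    by_cases hi : i.val % 2 = 0
    · rw [hGe i hi] at hv ⊢
      rw [deriv_comp_sub_const]
      exact deriv_oddTheta_ne_zero hτ hv
    · rw [hGo i hi] at hv ⊢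
      rw [deriv_comp_sub_const]
      exact D.deriv_B_ne_zero hv
  -- the zeros of `G i` lie in `basePoint i + (1/6) ℤ + (τ/2) ℤ`
  have hloc : ∀ i v, G i v = 0 → ∃ p q : ℤ, v = basePoint i + (p / 6 + q * τ / 2) := by
    intro i v hv
    by_cases hi : i.val % 2 = 0
    · rw [hGe i hi] at hv
      obtain ⟨k, l, h⟩ := (oddTheta_eq_zero_iff hτ).1 hv
      refine ⟨2 * k, 2 * l, ?_⟩
      push_cast
      linear_combination h
    · rw [hGo i hi] at hv
      obtain ⟨k, l, h⟩ := (oddTheta_eq_zero_iff hτ).1 (D.B_eq_zero_iff.1 hv)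
      refine ⟨2 * k + 3 * a, 2 * l + b, ?_⟩
      push_cast
      linear_combination h
  have hGd : ∀ i ∈ (Finset.univ : Finset (Fin m)), ∀ j ∈ (Finset.univ : Finset (Fin m)), i ≠ j →
      ∀ v, G i v = 0 → G j v ≠ 0 := by
    intro i _ j _ hij v hi hj
    by_cases hb : i.val / 2 = j.val / 2
    · have hbp : basePoint i = basePoint j := by rw [basePoint, basePoint, hb]
      have hne : i.val ≠ j.val := fun h => hij (Fin.ext h)
      by_cases hi2 : i.val % 2 = 0
      · rw [hGe i hi2, hbp] at hi
        rw [hGo j (by omega)] at hj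
        exact D.B_ne_zero_of_oddTheta_eq_zero hi hj
      · rw [hGo i hi2] at hi
        rw [hGe j (by omega), ← hbp] at hj
        exact D.B_ne_zero_of_oddTheta_eq_zero hj hi
    · obtain ⟨p, q, h1⟩ := hloc i v hi
      obtain ⟨p', q', h2⟩ := hloc j v hj
      refine int_mul_sqrt_two_ne hτ (k := (i.val / 2 : ℕ) - (j.val / 2 : ℕ)) (by omega)
        (p' - p) (q' - q) ?_
      rw [h1] at h2
      simp only [basePoint] at h2
      simp only [Int.cast_sub, Int.cast_natCast]
      linear_combination h2
  have hGz : ∀ i ∈ (Finset.univ : Finset (Fin m)), ∀ v, G i v = 0 → f v = 0 := by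
    intro i _ v hv
    by_cases hi : i.val % 2 = 0
    · rw [hGe i hi] at hv
      refine h3.zero_of_oddTheta_eq_zero hτ hf hα₁ hα₂ ?_ ?_ hv
      · simpa [specialPoint, hi] using hz i
      · by_cases hlast : i.val + 1 < m
        · have := hz ⟨i + 1, hlast⟩
          simpa [specialPoint, basePoint, show (i.val + 1) / 2 = i.val / 2 by omega,
            show (i.val + 1) % 2 = 1 by omega] using this
        · rwa [show m - 1 = i.val by omega] at h0
    · rw [hGo i hi] at hv
      have hv' := D.B_eq_zero_iff.1 hv
      rw [sub_sub] at hv'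
      refine h3.zero_of_oddTheta_eq_zero hτ hf hα₁ hα₂ ?_ ?_ hv'
      · have := hz' ⟨i - 1, by omega⟩
        simpa [specialPoint, basePoint, show (i.val - 1) / 2 = i.val / 2 by omega,
          show (i.val - 1) % 2 = 0 by omega] using this
      · have := hz' i
        simp only [specialPoint, show i.val % 2 = 1 by omega, Nat.cast_one, one_mul] at this
        rw [← this]; ring_nf
  obtain ⟨H, hH, hfGH⟩ := exists_entire_eq_prod_mul Finset.univ hf.entire
    (fun i hi => (hG i hi).entire) hGs hGd hGz
  have hprod := IsTheta.prod Finset.univ hG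
  -- the product is nonzero at a point whose imaginary part avoids `(1/2) Im τ ℤ`
  have hne : ∏ i, G i (τ / 4) ≠ 0 := by
    refine Finset.prod_ne_zero_iff.2 fun i _ h => ?_
    obtain ⟨p, q, h⟩ := hloc i _ h
    have hi := congrArg Complex.im h
    simp only [basePoint, add_im, mul_im, div_ofNat_im, intCast_im, intCast_re, natCast_re,
      natCast_im, ofReal_re, ofReal_im] at hi
    have : (1 - 2 * q : ℝ) = 0 := by
      refine (mul_eq_zero.1 ?_).resolve_right hτ.ne'
      linear_combination 4 * hi
    have : 1 - 2 * q = 0 := by exact_mod_cast this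
    omega
  have hHt := hf.of_eq_mul hprod
    (Finset.prod_ne_zero_iff.2 fun i _ => by
      split_ifs; exacts [by simp, ne_zero_of_sign D.β₁_eq])
    (Finset.prod_ne_zero_iff.2 fun i _ => by
      split_ifs; exacts [by simp, ne_zero_of_sign D.β₂_eq]) hne hH hfGH
  have hN : (3 * m - ∑ i : Fin m, 3 : ℂ) = 0 := by simp; ring
  rw [hN] at hHt
  have hS : (3 * ∑ i, specialPoint m i - ∑ i : Fin m, (0 + 3 * basePoint i) : ℂ).im = 0 := by
    rw [Finset.mul_sum, ← Finset.sum_sub_distrib, im_sum]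
    refine Finset.sum_eq_zero fun i _ => ?_
    rw [specialPoint, show 3 * (basePoint i + ((i.val % 2 : ℕ) : ℂ) * (2 / 3)) -
      (0 + 3 * basePoint i) = ((2 * (i.val % 2 : ℕ) : ℝ) : ℂ) by push_cast; ring, ofReal_im]
  have hHc := hHt.eq_const hτ
    (by
      rw [norm_div, norm_prod, norm_eq_one_of_sign D.α₁_eq, Finset.prod_eq_one, div_one]
      intro i _
      split_ifs
      exacts [by simp, norm_eq_one_of_sign D.β₁_eq])
    (by
      rw [norm_div, norm_prod, norm_eq_one_of_sign D.α₂_eq, Finset.prod_eq_one, div_one]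
      intro i _
      split_ifs
      exacts [by simp, norm_eq_one_of_sign D.β₂_eq]) hS
  refine h3.eq_zero_of_periodic (fun v => ?_) u
  rw [hfGH, hfGH, hHc (v + 2 / 3), hHc v]
  simp only [hGp]

/-! ### Sums over pairings -/

/-- The contribution of the pairing attached to `π`: the product of `A (zᵢ - zⱼ)` over the matched
and of `B (zᵢ - zⱼ)` over the unmatched pairs. -/
noncomputable def pairingTerm (n : ℕ) (A B : ℂ → ℂ) (z : Fin (2 * n) → ℂ)
    (π : Equiv.Perm (Fin (2 * n))) : ℂ :=
  (∏ k : Fin n, A (z (π ⟨2 * k, by omega⟩) - z (π ⟨2 * k + 1, by omega⟩))) *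
    ∏ q ∈ unmatched n π, B (z q.1 - z q.2)

/-- The pfaffian of `A (zᵢ - zⱼ) / B (zᵢ - zⱼ)` with denominators cleared, up to the
normalization. -/
noncomputable def pairingSum (n : ℕ) (A B : ℂ → ℂ) (z : Fin (2 * n) → ℂ) : ℂ :=
  ∑ π : Equiv.Perm (Fin (2 * n)), (Equiv.Perm.sign π : ℂ) * pairingTerm n A B z π

theorem differentiable_finset_prod {E ι : Type*} [NormedAddCommGroup E] [NormedSpace ℂ E]
    (s : Finset ι) {f : ι → E → ℂ} (hf : ∀ i, Differentiable ℂ (f i)) :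
    Differentiable ℂ (fun x => ∏ i ∈ s, f i x) := by
  classical
  induction s using Finset.induction_on with
  | empty => simp
  | insert a s ha ih => simp only [Finset.prod_insert ha]; exact (hf a).mul ih

theorem differentiable_pairingSum {n : ℕ} {A B : ℂ → ℂ} (hA : Differentiable ℂ A)
    (hB : Differentiable ℂ B) : Differentiable ℂ (pairingSum n A B) := by
  unfold pairingSum pairingTerm
  refine Differentiable.fun_sum fun π _ => (differentiable_const _).mul (Differentiable.mul ?_ ?_)
  · refine differentiable_finset_prod _ fun k => ?_
    exact hA.comp (g := A) (f := fun z : Fin (2 * n) → ℂ => z _ - z _) (by fun_prop)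
  · refine differentiable_finset_prod _ fun q => ?_
    exact hB.comp (g := B) (f := fun z : Fin (2 * n) → ℂ => z _ - z _) (by fun_prop)

theorem mem_unmatched {n : ℕ} {π : Equiv.Perm (Fin (2 * n))} {q : Fin (2 * n) × Fin (2 * n)} :
    q ∈ unmatched n π ↔ q.1 < q.2 ∧ ∀ k : Fin n,
      q ≠ (π ⟨2 * k, by omega⟩, π ⟨2 * k + 1, by omega⟩) ∧
      q ≠ (π ⟨2 * k + 1, by omega⟩, π ⟨2 * k, by omega⟩) := by
  simp [unmatched]

/-- Relabeling the indices by `ρ`; the symmetry of `b` takes care of the pairs that `ρ` puts in the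
wrong order. -/
theorem prod_unmatched_mul {n : ℕ} (ρ π : Equiv.Perm (Fin (2 * n)))
    {b : Fin (2 * n) → Fin (2 * n) → ℂ} (hb : ∀ i j, b j i = b i j) :
    ∏ q ∈ unmatched n (ρ * π), b q.1 q.2 = ∏ q ∈ unmatched n π, b (ρ q.1) (ρ q.2) := by
  have hmaps : ∀ ρ π : Equiv.Perm (Fin (2 * n)), ∀ q ∈ unmatched n π,
      (if ρ q.1 < ρ q.2 then (ρ q.1, ρ q.2) else (ρ q.2, ρ q.1)) ∈ unmatched n (ρ * π) := by
    intro ρ π q hq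
    rw [mem_unmatched] at hq ⊢
    have hne : ρ q.1 ≠ ρ q.2 := fun h => hq.1.ne (ρ.injective h)
    refine ⟨?_, fun k => ?_⟩
    · split_ifs with h
      · exact h
      · exact lt_of_le_of_ne (not_lt.1 h) hne.symm
    · have := hq.2 k
      obtain ⟨q1, q2⟩ := q
      simp only [ne_eq, Prod.mk.injEq, Equiv.Perm.mul_apply] at this ⊢
      split_ifs <;> simp only [Prod.mk.injEq, EmbeddingLike.apply_eq_iff_eq] <;> tauto
  symm
  refine Finset.prod_bij'
    (fun q _ => if ρ q.1 < ρ q.2 then (ρ q.1, ρ q.2) else (ρ q.2, ρ q.1))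
    (fun q _ => if ρ⁻¹ q.1 < ρ⁻¹ q.2 then (ρ⁻¹ q.1, ρ⁻¹ q.2) else (ρ⁻¹ q.2, ρ⁻¹ q.1))
    (hmaps ρ π) (fun q hq => by simpa using hmaps ρ⁻¹ (ρ * π) q hq) ?_ ?_ ?_
  · intro q hq
    have := (mem_unmatched.1 hq).1
    split_ifs <;> simp_all [not_lt_of_gt]
  · intro q hq
    have := (mem_unmatched.1 hq).1
    split_ifs <;> simp_all [not_lt_of_gt]
  · intro q _
    split_ifs with h
    · rfl
    · exact hb _ _

/-- The sum over pairings is antisymmetric, so it vanishes where two variables coincide. -/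
theorem pairingSum_eq_zero_of_eq {n : ℕ} {A B : ℂ → ℂ} (hB : ∀ v, B (-v) = B v)
    {z : Fin (2 * n) → ℂ} {i j : Fin (2 * n)} (hij : i ≠ j) (h : z i = z j) :
    pairingSum n A B z = 0 := by
  have hz : ∀ l, z (Equiv.swap i j l) = z l := by
    intro l
    rcases eq_or_ne l i with rfl | hi
    · rw [Equiv.swap_apply_left, h]
    rcases eq_or_ne l j with rfl | hj
    · rw [Equiv.swap_apply_right, h]
    rw [Equiv.swap_apply_of_ne_of_ne hi hj]
  have hterm : ∀ π, pairingTerm n A B z (Equiv.swap i j * π) = pairingTerm n A B z π := by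
    intro π
    rw [pairingTerm, pairingTerm,
      prod_unmatched_mul _ _ (b := fun i j => B (z i - z j)) fun i j => by rw [← hB, neg_sub]]
    simp only [Equiv.Perm.mul_apply, hz]
  refine Finset.sum_involution (fun π _ => Equiv.swap i j * π) ?_ ?_ ?_ ?_
  · intro π _
    rw [hterm, Equiv.Perm.sign_mul, Equiv.Perm.sign_swap hij]
    push_cast; ring
  · intro π _ _ he
    exact hij (Equiv.swap_eq_one_iff.1 (mul_eq_right.1 he))
  · intro π _; exact Finset.mem_univ _
  · intro π _; simp [← mul_assoc]

theorem prepend_zero {n : ℕ} (u : ℂ) (z : Fin (2 * n - 1) → ℂ) {i : Fin (2 * n)}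
    (hi : i.val = 0) : prepend u z i = u := by simp [prepend, hi]

theorem prepend_succ {n : ℕ} (u : ℂ) (z : Fin (2 * n - 1) → ℂ) (k : Fin (2 * n - 1)) :
    prepend u z ⟨k + 1, by omega⟩ = z k := by simp [prepend]

theorem prepend_congr {n : ℕ} (u v : ℂ) (z : Fin (2 * n - 1) → ℂ) {i : Fin (2 * n)}
    (hi : i.val ≠ 0) : prepend u z i = prepend v z i := by simp [prepend, hi]

/-- As a function of the first variable, the contribution of a pairing only depends on the partner
of that variable, up to a constant. -/
theorem exists_pairingTerm_prepend_eq {n : ℕ} (hn : 0 < n) {A : ℂ → ℂ} (B : ℂ → ℂ)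
    (hA : ∀ v, A (-v) = -A v) (π : Equiv.Perm (Fin (2 * n))) (z : Fin (2 * n - 1) → ℂ) :
    ∃ (j : Fin (2 * n - 1)) (K : ℂ), ∀ u, pairingTerm n A B (prepend u z) π =
      K * (A (u - z j) * ∏ k ∈ Finset.univ.erase j, B (u - z k)) := by
  classical
  let o : Fin (2 * n) := ⟨0, by omega⟩
  -- the pair `k₀` that contains the first index, and the partner `p` of the latter
  obtain ⟨k₀, p, hk₀⟩ : ∃ (k₀ : Fin n) (p : Fin (2 * n)),
      (π ⟨2 * k₀, by omega⟩ = o ∧ π ⟨2 * k₀ + 1, by omega⟩ = p) ∨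
      (π ⟨2 * k₀ + 1, by omega⟩ = o ∧ π ⟨2 * k₀, by omega⟩ = p) := by
    obtain ⟨s, hs⟩ := π.surjective o
    rcases Nat.even_or_odd' s.val with ⟨c, hc | hc⟩
    · refine ⟨⟨c, by omega⟩, _, Or.inl ⟨?_, rfl⟩⟩
      rw [← hs]; congr 1; exact Fin.ext hc.symm
    · refine ⟨⟨c, by omega⟩, _, Or.inr ⟨?_, rfl⟩⟩
      rw [← hs]; congr 1; exact Fin.ext hc.symm
  have hpo : p ≠ o := by
    rintro rfl
    rcases hk₀ with ⟨h1, h2⟩ | ⟨h1, h2⟩ <;>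
    · have := congrArg Fin.val (π.injective (h1.trans h2.symm))
      simp at this
  have hp0 : p.val ≠ 0 := fun h => hpo (Fin.ext h)
  obtain ⟨j, hj⟩ : ∃ j : Fin (2 * n - 1), p = ⟨j + 1, by omega⟩ :=
    ⟨⟨p - 1, by omega⟩, Fin.ext (by simp; omega)⟩
  have hrest : ∀ k : Fin n, k ≠ k₀ →
      (π ⟨2 * k, by omega⟩).val ≠ 0 ∧ (π ⟨2 * k + 1, by omega⟩).val ≠ 0 := by
    intro k hk
    have hkv : k.val ≠ k₀.val := fun h => hk (Fin.ext h)
    constructor <;> intro h <;> rcases hk₀ with ⟨h1, -⟩ | ⟨h1, -⟩ <;>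
    · have := congrArg Fin.val (π.injective ((Fin.ext h : _ = o).trans h1.symm))
      simp at this
      omega
  -- the factors that contain the first variable
  obtain ⟨ε, hε⟩ : ∃ ε : ℂ, ∀ u, A (prepend u z (π ⟨2 * k₀, by omega⟩) -
      prepend u z (π ⟨2 * k₀ + 1, by omega⟩)) = ε * A (u - z j) := by
    rcases hk₀ with ⟨h1, h2⟩ | ⟨h1, h2⟩
    · refine ⟨1, fun u => ?_⟩
      rw [h1, h2, hj, prepend_succ, prepend_zero u z rfl, one_mul]
    · refine ⟨-1, fun u => ?_⟩
      rw [h1, h2, hj, prepend_succ, prepend_zero u z rfl, ← neg_sub, hA]; ring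
  have hB : ∀ u, ∏ q ∈ unmatched n π with q.1 = o, B (prepend u z q.1 - prepend u z q.2) =
      ∏ k ∈ Finset.univ.erase j, B (u - z k) := by
    intro u
    symm
    refine Finset.prod_bij (fun k _ => (o, ⟨k + 1, by omega⟩)) ?_ ?_ ?_ ?_
    · intro k hk
      have hkj : k ≠ j := Finset.ne_of_mem_erase hk
      have hkp : (⟨k + 1, by omega⟩ : Fin (2 * n)) ≠ p := by
        rw [hj]; intro h; apply hkj; simpa [Fin.ext_iff] using h
      rw [Finset.mem_filter, mem_unmatched]
      refine ⟨⟨by simp [o, Fin.lt_def], fun l => ?_⟩, rfl⟩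
      by_cases hl : l = k₀
      · subst hl
        simp only [ne_eq, Prod.mk.injEq, not_and]
        rcases hk₀ with ⟨h1, h2⟩ | ⟨h1, h2⟩ <;> rw [h1, h2]
        · exact ⟨fun _ => hkp, fun h => absurd h.symm hpo⟩
        · exact ⟨fun h => absurd h.symm hpo, fun _ => hkp⟩
      · obtain ⟨h1, h2⟩ := hrest l hl
        simp only [ne_eq, Prod.mk.injEq, not_and]
        exact ⟨fun h => absurd (congrArg Fin.val h).symm h1,
          fun h => absurd (congrArg Fin.val h).symm h2⟩
    · intro k _ l _ h
      simpa [Fin.ext_iff] using h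
    · intro q hq
      rw [Finset.mem_filter, mem_unmatched] at hq
      obtain ⟨⟨hlt, hq⟩, hqo⟩ := hq
      have hq2 : q.2.val ≠ 0 := by
        have : o < q.2 := hqo ▸ hlt
        exact (Fin.lt_def.1 this).ne'
      have hqp : q.2 ≠ p := by
        intro h
        rcases hk₀ with ⟨h1, h2⟩ | ⟨h1, h2⟩
        · exact (hq k₀).1 (Prod.ext (hqo.trans h1.symm) (h.trans h2.symm))
        · exact (hq k₀).2 (Prod.ext (hqo.trans h1.symm) (h.trans h2.symm))
      refine ⟨⟨q.2 - 1, by omega⟩, Finset.mem_erase.2 ⟨?_, Finset.mem_univ _⟩, ?_⟩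
      · intro h
        exact hqp (by rw [hj, ← h]; exact Fin.ext (by simp; omega))
      · exact Prod.ext hqo.symm (Fin.ext (by simp; omega))
    · intro k _
      rw [prepend_succ, prepend_zero u z rfl]
  refine ⟨j, ε * (∏ k ∈ Finset.univ.erase k₀, A (prepend 0 z (π ⟨2 * k, by omega⟩) -
      prepend 0 z (π ⟨2 * k + 1, by omega⟩))) *
    ∏ q ∈ unmatched n π with ¬ q.1 = o, B (prepend 0 z q.1 - prepend 0 z q.2), fun u => ?_⟩
  have hA' : ∏ k ∈ Finset.univ.erase k₀, A (prepend u z (π ⟨2 * k, by omega⟩) -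
      prepend u z (π ⟨2 * k + 1, by omega⟩)) =
      ∏ k ∈ Finset.univ.erase k₀, A (prepend 0 z (π ⟨2 * k, by omega⟩) -
      prepend 0 z (π ⟨2 * k + 1, by omega⟩)) := by
    refine Finset.prod_congr rfl fun k hk => ?_
    obtain ⟨h1, h2⟩ := hrest k (Finset.ne_of_mem_erase hk)
    rw [prepend_congr u 0 z h1, prepend_congr u 0 z h2]
  have hB' : ∏ q ∈ unmatched n π with ¬ q.1 = o, B (prepend u z q.1 - prepend u z q.2) =
      ∏ q ∈ unmatched n π with ¬ q.1 = o, B (prepend 0 z q.1 - prepend 0 z q.2) := by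
    refine Finset.prod_congr rfl fun q hq => ?_
    rw [Finset.mem_filter, mem_unmatched] at hq
    have h1 : q.1.val ≠ 0 := fun h => hq.2 (Fin.ext h)
    have h2 : q.2.val ≠ 0 := by have := Fin.lt_def.1 hq.1.1; omega
    rw [prepend_congr u 0 z h1, prepend_congr u 0 z h2]
  rw [pairingTerm, ← Finset.mul_prod_erase _ _ (Finset.mem_univ k₀), hε, hA',
    ← Finset.prod_filter_mul_prod_filter_not (unmatched n π) (fun q => q.1 = o), hB, hB']
  ring

/-- The sign of a permutation of `n` blocks of size two: permuting whole blocks is even, so only the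
flips within the blocks count. -/
theorem sign_eq_prod_sign_of_blocks {n : ℕ} (e : Fin n × Fin 2 ≃ Fin (2 * n))
    {π : Equiv.Perm (Fin (2 * n))} (T : Equiv.Perm (Fin n)) (s : Fin n → Equiv.Perm (Fin 2))
    (h : ∀ k x, π (e (k, x)) = e (T k, s k x)) :
    Equiv.Perm.sign π = ∏ k, Equiv.Perm.sign (s k) := by
  have hp : π =
      e.permCongr (Equiv.prodCongrLeft (fun _ : Fin 2 => T) * Equiv.prodCongrRight s) := by
    ext1 i
    obtain ⟨⟨k, x⟩, rfl⟩ := e.surjective i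
    simp [Equiv.permCongr_apply, h]
  rw [hp, Equiv.Perm.sign_permCongr, Equiv.Perm.sign_mul, Equiv.Perm.sign_prodCongrLeft,
    Equiv.Perm.sign_prodCongrRight]
  simp

/-- If `B` vanishes at the differences within the standard pairs, then only the standard pairing
contributes to the sum, and all `2 ^ n n!` permutations attached to it contribute equally. -/
theorem pairingSum_ne_zero {n : ℕ} {A B : ℂ → ℂ} (hA : ∀ v, A (-v) = -A v)
    (hB : ∀ v, B (-v) = B v) {z : Fin (2 * n) → ℂ} {c : ℂ} (hc : c ≠ 0)
    (hzA : ∀ k : Fin n, A (z ⟨2 * k, by omega⟩ - z ⟨2 * k + 1, by omega⟩) = c)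
    (hzB : ∀ k : Fin n, B (z ⟨2 * k, by omega⟩ - z ⟨2 * k + 1, by omega⟩) = 0)
    (hz : ∀ i j : Fin (2 * n), i.val / 2 ≠ j.val / 2 → B (z i - z j) ≠ 0) :
    pairingSum n A B z ≠ 0 := by
  classical
  let good : Equiv.Perm (Fin (2 * n)) → Prop := fun π =>
    ∀ k : Fin n, (⟨2 * k, by omega⟩, ⟨2 * k + 1, by omega⟩) ∉ unmatched n π
  let b : Fin (2 * n) → Fin (2 * n) → ℂ := fun i j =>
    if i.val / 2 = j.val / 2 then 1 else B (z i - z j)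
  have hbsymm : ∀ i j, b j i = b i j := by
    intro i j
    simp only [b]
    rw [← hB (z j - z i), neg_sub]
    simp only [eq_comm]
  let R : ℂ := ∏ q : Fin (2 * n) × Fin (2 * n) with q.1 < q.2, b q.1 q.2
  have hR : R ≠ 0 := Finset.prod_ne_zero_iff.2 fun q _ => by
    simp only [b]
    split_ifs with h
    · exact one_ne_zero
    · exact hz _ _ h
  have hbad : ∀ π, ¬ good π → (Equiv.Perm.sign π : ℂ) * pairingTerm n A B z π = 0 := by
    intro π hπ
    simp only [good, not_forall, not_not] at hπ
    obtain ⟨k, hk⟩ := hπ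
    rw [pairingTerm, Finset.prod_eq_zero hk (hzB k), mul_zero, mul_zero]
  have hgood : ∀ π, good π → (Equiv.Perm.sign π : ℂ) * pairingTerm n A B z π = c ^ n * R := by
    intro π hπ
    have hex : ∀ k : Fin n, ∃ l : Fin n, ∃ s : Equiv.Perm (Fin 2),
        (s = 1 ∧ π ⟨2 * l, by omega⟩ = ⟨2 * k, by omega⟩ ∧
          π ⟨2 * l + 1, by omega⟩ = ⟨2 * k + 1, by omega⟩) ∨
        (s = Equiv.swap 0 1 ∧ π ⟨2 * l + 1, by omega⟩ = ⟨2 * k, by omega⟩ ∧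
          π ⟨2 * l, by omega⟩ = ⟨2 * k + 1, by omega⟩) := by
      intro k
      have := hπ k
      rw [mem_unmatched] at this
      simp only [Fin.mk_lt_mk, Nat.lt_succ_self, true_and] at this
      push Not at this
      obtain ⟨l, h⟩ := this
      by_cases h' : ((⟨2 * k, by omega⟩, ⟨2 * k + 1, by omega⟩) : Fin (2 * n) × Fin (2 * n)) =
        (π ⟨2 * l, by omega⟩, π ⟨2 * l + 1, by omega⟩)
      · exact ⟨l, 1, Or.inl ⟨rfl, (congrArg Prod.fst h').symm, (congrArg Prod.snd h').symm⟩⟩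
      · have h'' := h h'
        exact ⟨l, Equiv.swap 0 1,
          Or.inr ⟨rfl, (congrArg Prod.fst h'').symm, (congrArg Prod.snd h'').symm⟩⟩
    choose t s hts using hex
    have hblock : ∀ k, (π ⟨2 * t k, by omega⟩).val / 2 = k.val ∧
        (π ⟨2 * t k + 1, by omega⟩).val / 2 = k.val := by
      intro k
      rcases hts k with ⟨-, h1, h2⟩ | ⟨-, h1, h2⟩ <;> rw [h1, h2] <;> constructor <;>
        simp <;> omega
    have htinj : Function.Injective t := by
      intro k l h
      have h1 := (hblock k).1
      simp only [h] at h1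
      exact Fin.ext (h1.symm.trans (hblock l).1)
    let T : Equiv.Perm (Fin n) := Equiv.ofBijective t (Finite.injective_iff_bijective.1 htinj)
    let e : Fin n × Fin 2 ≃ Fin (2 * n) := finProdFinEquiv.trans (finCongr (mul_comm n 2))
    have he0 : ∀ k : Fin n, e (k, 0) = ⟨2 * k, by omega⟩ := fun k => Fin.ext (by simp [e])
    have he1 : ∀ k : Fin n, e (k, 1) = ⟨2 * k + 1, by omega⟩ :=
      fun k => Fin.ext (by simp [e, add_comm])
    have hsign : Equiv.Perm.sign π = ∏ k, Equiv.Perm.sign (s k) := by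
      rw [← Equiv.Perm.sign_inv]
      refine sign_eq_prod_sign_of_blocks e T s fun k x => ?_
      rw [Equiv.Perm.inv_eq_iff_eq]
      have hT : T k = t k := rfl
      simp only [hT]
      fin_cases x <;> rcases hts k with ⟨h0, h1, h2⟩ | ⟨h0, h1, h2⟩ <;> rw [h0] <;>
        simp [he0, he1, h1, h2]
    have hAprod : ∏ k : Fin n, A (z (π ⟨2 * k, by omega⟩) - z (π ⟨2 * k + 1, by omega⟩)) =
        (∏ k, ((Equiv.Perm.sign (s k) : ℤˣ) : ℂ)) * c ^ n := by
      rw [← Equiv.prod_comp T]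
      have : ∀ k, A (z (π ⟨2 * T k, by omega⟩) - z (π ⟨2 * T k + 1, by omega⟩)) =
          ((Equiv.Perm.sign (s k) : ℤˣ) : ℂ) * c := by
        intro k
        have hT : T k = t k := rfl
        simp only [hT]
        rcases hts k with ⟨h0, h1, h2⟩ | ⟨h0, h1, h2⟩ <;> rw [h0, h1, h2]
        · rw [hzA]; simp
        · rw [← neg_sub, hA, hzA, Equiv.Perm.sign_swap (by decide)]; simp
      rw [Finset.prod_congr rfl fun k _ => this k, Finset.prod_mul_distrib]
      simp
    have hBprod : ∏ q ∈ unmatched n π, B (z q.1 - z q.2) = R := by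
      have hone : ∏ k : Fin n, b (π ⟨2 * k, by omega⟩) (π ⟨2 * k + 1, by omega⟩) = 1 := by
        refine Finset.prod_eq_one fun k _ => ?_
        obtain ⟨l, rfl⟩ := T.surjective k
        have hT : T l = t l := rfl
        simp only [hT, b, (hblock l).1, (hblock l).2, if_true]
      simp only [R]
      rw [prod_lt_eq π b hbsymm, hone, one_mul]
      refine Finset.prod_congr rfl fun q hq => ?_
      have hlt := Fin.lt_def.1 (mem_unmatched.1 hq).1
      have hne : ¬ q.1.val / 2 = q.2.val / 2 := by
        intro h
        refine hπ ⟨q.1 / 2, by omega⟩ ?_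
        have he : ((⟨2 * (q.1 / 2), by omega⟩, ⟨2 * (q.1 / 2) + 1, by omega⟩) :
            Fin (2 * n) × Fin (2 * n)) = q :=
          Prod.ext (Fin.ext (show 2 * (q.1.val / 2) = q.1.val by omega))
            (Fin.ext (show 2 * (q.1.val / 2) + 1 = q.2.val by omega))
        rwa [← he] at hq
      simp only [b, hne, if_false]
    rw [pairingTerm, hAprod, hBprod, hsign]
    push_cast
    rw [← mul_assoc, ← mul_assoc, ← Finset.prod_mul_distrib, Finset.prod_eq_one, one_mul]
    intro k _
    rcases Int.units_eq_one_or (Equiv.Perm.sign (s k)) with h | h <;> rw [h] <;> simp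
  have hsum : pairingSum n A B z = ∑ π with good π, c ^ n * R := by
    rw [pairingSum, Finset.sum_filter]
    refine Finset.sum_congr rfl fun π _ => ?_
    split_ifs with h
    · exact hgood π h
    · exact hbad π h
  have hone : good 1 := by
    intro k hk
    exact ((mem_unmatched.1 hk).2 k).1 rfl
  rw [hsum, Finset.sum_const, nsmul_eq_mul]
  refine mul_ne_zero ?_ (mul_ne_zero (pow_ne_zero _ hc) hR)
  rw [Nat.cast_ne_zero]
  exact Finset.card_ne_zero_of_mem (Finset.mem_filter.2 ⟨Finset.mem_univ 1, hone⟩)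

/-! ### Generic uniqueness -/

theorem IsTheta.sum {ι : Type*} [DecidableEq ι] {τ c₁ c₂ N S : ℂ} (s : Finset ι) {f : ι → ℂ → ℂ}
    (hf : ∀ i ∈ s, IsTheta τ c₁ c₂ N S (f i)) :
    IsTheta τ c₁ c₂ N S (fun u => ∑ i ∈ s, f i u) := by
  induction s using Finset.induction_on with
  | empty => exact ⟨by simp, by simp, by simp⟩
  | insert a s ha ih =>
    simp only [Finset.sum_insert ha]
    exact (hf a (Finset.mem_insert_self a s)).add
      (ih fun i hi => hf i (Finset.mem_insert_of_mem hi))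

theorem ThreeTermThird.const_mul {f : ℂ → ℂ} (c : ℂ) (hf : ThreeTermThird f) :
    ThreeTermThird (fun u => c * f u) := fun u => by
  linear_combination c * hf u

theorem ThreeTermThird.add {f g : ℂ → ℂ} (hf : ThreeTermThird f) (hg : ThreeTermThird g) :
    ThreeTermThird (fun u => f u + g u) := fun u => by
  linear_combination hf u + hg u

theorem ThreeTermThird.sum {ι : Type*} (s : Finset ι) {f : ι → ℂ → ℂ}
    (hf : ∀ i ∈ s, ThreeTermThird (f i)) : ThreeTermThird (fun u => ∑ i ∈ s, f i u) := by
  intro u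
  beta_reduce
  rw [← Finset.sum_add_distrib, ← Finset.sum_add_distrib]
  exact Finset.sum_eq_zero fun i hi => hf i hi u

/-- If the conditions `f (x r) = 0` on the elements of a space of entire functions imply `f = 0` at
one point `x₀`, then they do so at generic points: the determinant of the conditions, composed with
a left inverse at `x₀`, is an entire function of the points. -/
theorem exists_entire_of_eval_injective {m : ℕ} {R : Type*} [Finite R] (V : Submodule ℂ (ℂ → ℂ))
    (hV : ∀ f ∈ V, Differentiable ℂ f) {pt : (Fin m → ℂ) → R → ℂ}
    (hpt : ∀ r, Differentiable ℂ (fun x => pt x r)) {x₀ : Fin m → ℂ}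
    (h0 : ∀ f ∈ V, (∀ r, f (pt x₀ r) = 0) → f = 0) :
    ∃ G : (Fin m → ℂ) → ℂ, Differentiable ℂ G ∧ G x₀ ≠ 0 ∧
      ∀ x, G x ≠ 0 → ∀ f ∈ V, (∀ r, f (pt x r) = 0) → f = 0 := by
  classical
  cases nonempty_fintype R
  let ev : (Fin m → ℂ) → V →ₗ[ℂ] (R → ℂ) := fun x =>
    LinearMap.pi fun r => (LinearMap.proj (pt x r)).comp V.subtype
  have hev : ∀ x (f : V) r, ev x f r = f.1 (pt x r) := fun _ _ _ => rfl
  have hker : LinearMap.ker (ev x₀) = ⊥ := by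
    rw [LinearMap.ker_eq_bot']
    intro f hf
    exact Subtype.ext (h0 f.1 f.2 fun r => by rw [← hev, hf]; rfl)
  have : FiniteDimensional ℂ V := Module.Finite.of_injective (ev x₀) (LinearMap.ker_eq_bot.1 hker)
  obtain ⟨L, hL⟩ := (ev x₀).exists_leftInverse_of_injective hker
  let b := Module.finBasis ℂ V
  refine ⟨fun x => (LinearMap.toMatrix b b (L ∘ₗ ev x)).det, ?_, ?_, ?_⟩
  · simp only [Matrix.det_apply']
    refine Differentiable.fun_sum fun π _ => (differentiable_const _).mul
      (differentiable_finset_prod _ fun i => ?_)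
    have he : (fun x => LinearMap.toMatrix b b (L ∘ₗ ev x) (π i) i) =
        fun x => LinearMap.toContinuousLinearMap ((b.coord (π i)).comp L)
          (fun r => (b i).1 (pt x r)) := by
      funext x
      rw [LinearMap.toMatrix_apply]
      rfl
    rw [he]
    refine (ContinuousLinearMap.differentiable _).comp (differentiable_pi.2 fun r => ?_)
    exact (hV _ (b i).2).comp (hpt r)
  · simp [hL]
  · intro x hx f hf hfx
    have hdet : LinearMap.det (L ∘ₗ ev x) ≠ 0 := by rwa [← LinearMap.det_toMatrix b]
    have hk : LinearMap.ker (L ∘ₗ ev x) = ⊥ := by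
      by_contra h
      exact hdet (LinearMap.det_eq_zero_iff_ker_ne_bot.2 h)
    have hfx' : ev x ⟨f, hf⟩ = 0 := funext fun r => hfx r
    have := LinearMap.ker_eq_bot'.1 hk ⟨f, hf⟩ (by rw [LinearMap.comp_apply, hfx', map_zero])
    exact congrArg Subtype.val this

/-- The theta functions of degree `N`, centered at the origin, with the three-term relation. -/
def thetaSpace (τ c₁ c₂ N : ℂ) : Submodule ℂ (ℂ → ℂ) where
  carrier := {f | IsTheta τ c₁ c₂ N 0 f ∧ ThreeTermThird f}
  add_mem' hf hg := ⟨hf.1.add hg.1, hf.2.add hg.2⟩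
  zero_mem' := ⟨⟨differentiable_const 0, by simp, by simp⟩, fun u => by simp⟩
  smul_mem' c _ hf := ⟨hf.1.const_mul c, hf.2.const_mul c⟩

namespace ThetaPair

variable {τ α₁ α₂ β₁ β₂ : ℂ} {a b : ℤ} {A B : ℂ → ℂ}

/-- The pairing sum satisfies all the conditions as a function of its first variable. -/
theorem pairingSum_prepend (D : ThetaPair τ α₁ α₂ β₁ β₂ a b A B) {n : ℕ} (hn : 0 < n)
    (z : Fin (2 * n - 1) → ℂ) :
    IsTheta τ α₁ α₂ (3 * (2 * n - 1 : ℕ)) (3 * ∑ i, z i)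
        (fun u => pairingSum n A B (prepend u z)) ∧
      ThreeTermThird (fun u => pairingSum n A B (prepend u z)) ∧
      (∀ j, pairingSum n A B (prepend (z j) z) = 0) ∧
      ∀ j, pairingSum n A B (prepend (z j + (a + b * τ) / 2) z) = 0 := by
  classical
  choose j K hK using exists_pairingTerm_prepend_eq hn B D.odd_A (z := z)
  have hterm : ∀ i : Fin (2 * n - 1), IsTheta τ α₁ α₂ (3 * (2 * n - 1 : ℕ)) (3 * ∑ i, z i)
      (fun u => A (u - z i) * ∏ k ∈ Finset.univ.erase i, B (u - z k)) := by
    intro i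
    have h := (D.isTheta_A.comp_sub (z i)).mul
      (IsTheta.prod (Finset.univ.erase i) fun k _ => D.isTheta_B.comp_sub (z k))
    -- the number of factors `B` is even, so their characters cancel
    have hcard : (Finset.univ.erase i).card = 2 * (n - 1) := by
      rw [Finset.card_erase_of_mem (Finset.mem_univ i), Finset.card_univ, Fintype.card_fin]
      omega
    have hβ : ∀ {β : ℂ}, (β = 1 ∨ β = -1) → ∏ _k ∈ Finset.univ.erase i, β = 1 := fun hβ => by
      rw [Finset.prod_const, hcard, pow_mul, sq, mul_self_of_sign hβ, one_pow]
    rw [hβ D.β₁_eq, hβ D.β₂_eq, mul_one, mul_one,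
      Finset.add_sum_erase Finset.univ (fun k => 0 + 3 * z k) (Finset.mem_univ i),
      Finset.add_sum_erase Finset.univ (fun _ => (3 : ℂ)) (Finset.mem_univ i)] at h
    simp only [zero_add, ← Finset.mul_sum, Finset.sum_const, Finset.card_univ, Fintype.card_fin,
      nsmul_eq_mul] at h
    rwa [mul_comm _ (3 : ℂ)] at h
  have hterm3 : ∀ i : Fin (2 * n - 1),
      ThreeTermThird (fun u => A (u - z i) * ∏ k ∈ Finset.univ.erase i, B (u - z k)) := by
    intro i u
    have h1 : ∏ k ∈ Finset.univ.erase i, B (u + 2 / 3 - z k) =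
        ∏ k ∈ Finset.univ.erase i, B (u - z k) := Finset.prod_congr rfl fun k _ => by
      rw [show u + 2 / 3 - z k = u - z k + 2 / 3 by ring, D.B_two_thirds]
    have h2 : ∏ k ∈ Finset.univ.erase i, B (u - 2 / 3 - z k) =
        ∏ k ∈ Finset.univ.erase i, B (u - z k) := Finset.prod_congr rfl fun k _ => by
      rw [← D.B_two_thirds, show u - 2 / 3 - z k + 2 / 3 = u - z k by ring]
    have h3 := D.three_term_A (u - z i)
    beta_reduce
    rw [h1, h2, show u + 2 / 3 - z i = u - z i + 2 / 3 by ring,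
      show u - 2 / 3 - z i = u - z i - 2 / 3 by ring]
    linear_combination (∏ k ∈ Finset.univ.erase i, B (u - z k)) * h3
  have hsum : (fun u => pairingSum n A B (prepend u z)) = fun u =>
      ∑ π : Equiv.Perm (Fin (2 * n)), ((Equiv.Perm.sign π : ℂ) * K π) *
        (A (u - z (j π)) * ∏ k ∈ Finset.univ.erase (j π), B (u - z k)) := by
    funext u
    refine Finset.sum_congr rfl fun π _ => ?_
    rw [hK, mul_assoc]
  refine ⟨?_, ?_, fun i => ?_, fun i => ?_⟩
  · rw [hsum]
    exact IsTheta.sum _ fun π _ => (hterm _).const_mul _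
  · rw [hsum]
    exact ThreeTermThird.sum _ fun π _ => (hterm3 _).const_mul _
  · refine pairingSum_eq_zero_of_eq D.even_B (i := ⟨0, by omega⟩) (j := ⟨i + 1, by omega⟩)
      (by simp) ?_
    rw [prepend_succ, prepend_zero _ _ rfl]
  · -- the factor `A` vanishes if `i` is the partner, and one of the factors `B` if it is not
    refine (congrFun hsum _).trans (Finset.sum_eq_zero fun π _ => ?_)
    by_cases hi : i = j π
    · rw [← hi, add_sub_cancel_left, D.A_half]; ring
    · rw [Finset.prod_eq_zero (Finset.mem_erase.2 ⟨hi, Finset.mem_univ i⟩)]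
      · ring
      · rw [add_sub_cancel_left, D.B_half]

theorem exists_pairingSum_prepend_ne_zero (D : ThetaPair τ α₁ α₂ β₁ β₂ a b A B) {n : ℕ}
    (hn : 0 < n) (u₀ : ℂ) : ∃ z : Fin (2 * n - 1) → ℂ, pairingSum n A B (prepend u₀ z) ≠ 0 := by
  let d : ℂ := (a + b * τ) / 2 + 2 / 3
  let y : Fin (2 * n) → ℂ := fun i => u₀ + basePoint i - ((i.val % 2 : ℕ) : ℂ) * d
  have hy : y = prepend u₀ (fun k => y ⟨k + 1, by omega⟩) := by
    funext i
    by_cases hi : i.val = 0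
    · rw [prepend_zero _ _ hi]; simp [y, hi, basePoint]
    · simp only [prepend, hi, dif_neg, not_false_eq_true]
      congr 1
      exact Fin.ext (show i.val = i.val - 1 + 1 by omega)
  have hpair : ∀ k : Fin n, y ⟨2 * k, by omega⟩ - y ⟨2 * k + 1, by omega⟩ = d := by
    intro k
    simp only [y, basePoint, show (2 * k.val + 1) / 2 = k.val by omega,
      show (2 * k.val) / 2 = k.val by omega, show (2 * k.val + 1) % 2 = 1 by omega,
      show (2 * k.val) % 2 = 0 by omega]
    push_cast; ring
  refine ⟨fun k => y ⟨k + 1, by omega⟩, ?_⟩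
  rw [← hy]
  refine pairingSum_ne_zero D.odd_A D.even_B D.A_half_add_ne_zero (fun k => by rw [hpair])
    (fun k => ?_) fun i j hij h => ?_
  · rw [hpair, D.B_eq_zero_iff, add_sub_cancel_left]
    exact (oddTheta_eq_zero_iff D.im_pos).2 ⟨2, 0, by norm_num⟩
  · obtain ⟨k, l, hkl⟩ := (oddTheta_eq_zero_iff D.im_pos).1 (D.B_eq_zero_iff.1 h)
    obtain ⟨x, hx⟩ : ∃ x : ℤ, x = (i.val % 2 : ℕ) - (j.val % 2 : ℕ) := ⟨_, rfl⟩
    have hx' : (x : ℂ) = (i.val % 2 : ℕ) - (j.val % 2 : ℕ) := by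
      rw [hx, Int.cast_sub, Int.cast_natCast, Int.cast_natCast]
    refine int_mul_sqrt_two_ne D.im_pos (k := (i.val / 2 : ℕ) - (j.val / 2 : ℕ)) (by omega)
      (2 * k + 3 * (x + 1) * a + 4 * x) (2 * l + (x + 1) * b) ?_
    simp only [y, basePoint, d] at hkl
    simp only [Int.cast_sub, Int.cast_natCast, Int.cast_add, Int.cast_mul, hx', Int.cast_ofNat,
      Int.cast_one]
    linear_combination hkl

/-- For generic `z`, the conditions determine `f` up to a constant, and `f` is a multiple of the
pairing sum. -/
theorem holdsGenerically (D : ThetaPair τ α₁ α₂ β₁ β₂ a b A B) {n : ℕ} (hn : 0 < n) :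
    HoldsGenerically (fun z : Fin (2 * n - 1) → ℂ => ∀ f : ℂ → ℂ,
      IsTheta τ α₁ α₂ (3 * (2 * n - 1 : ℕ)) (3 * ∑ i, z i) f → ThreeTermThird f →
      (∀ j, f (z j) = 0) → (∀ j, f (z j + (a + b * τ) / 2) = 0) →
      ∃ C : ℂ, ∀ u, f u = C * pairingSum n A B (prepend u z)) := by
  have hm0 : ((2 * n - 1 : ℕ) : ℂ) ≠ 0 := by rw [Nat.cast_ne_zero]; omega
  -- the point `w + 2 / 3`, where `w` is the last coordinate of the special point
  let u₀ : ℂ := basePoint (2 * n - 2) + 2 / 3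
  -- the conditions, after a translation that makes the space independent of `z`
  let pt : (Fin (2 * n - 1) → ℂ) → (Fin (2 * n - 1) ⊕ Fin (2 * n - 1) ⊕ Unit) → ℂ :=
    fun z => Sum.elim (fun j => z j - (∑ i, z i) / (2 * n - 1 : ℕ))
      (Sum.elim (fun j => z j + (a + b * τ) / 2 - (∑ i, z i) / (2 * n - 1 : ℕ))
        fun _ => u₀ - (∑ i, z i) / (2 * n - 1 : ℕ))
  obtain ⟨G, hG, hG0, hGV⟩ := exists_entire_of_eval_injective
    (thetaSpace τ α₁ α₂ (3 * (2 * n - 1 : ℕ))) (fun f hf => hf.1.entire) (pt := pt)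
    (x₀ := specialPoint (2 * n - 1))
    (by rintro (r | r | r) <;> simp only [pt, Sum.elim_inl, Sum.elim_inr] <;> fun_prop)
    (by
      intro f hf hfx
      have ht := hf.1.comp_sub ((∑ i, specialPoint (2 * n - 1) i) / (2 * n - 1 : ℕ))
      have e : (0 + 3 * (2 * n - 1 : ℕ) *
          ((∑ i, specialPoint (2 * n - 1) i) / (2 * n - 1 : ℕ)) : ℂ) =
        3 * ∑ i, specialPoint (2 * n - 1) i := by field_simp; ring
      rw [e] at ht
      have h3 : ThreeTermThird
          (fun u => f (u - (∑ i, specialPoint (2 * n - 1) i) / (2 * n - 1 : ℕ))) := by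
        simpa [sub_eq_add_neg] using
          hf.2.comp_add (-((∑ i, specialPoint (2 * n - 1) i) / (2 * n - 1 : ℕ)))
      have h := D.eq_zero_of_specialPoint hn ht h3
        (fun i => by simpa [pt] using hfx (Sum.inl i))
        (fun i => by simpa [pt] using hfx (Sum.inr (Sum.inl i)))
        (by simpa [pt, u₀] using hfx (Sum.inr (Sum.inr ())))
      funext u
      simpa using h (u + (∑ i, specialPoint (2 * n - 1) i) / (2 * n - 1 : ℕ)))
  have hP : Differentiable ℂ (fun z : Fin (2 * n - 1) → ℂ => pairingSum n A B (prepend u₀ z)) := by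
    refine (differentiable_pairingSum D.isTheta_A.entire D.isTheta_B.entire).comp
      (differentiable_pi.2 fun i => ?_)
    unfold prepend
    split_ifs <;> fun_prop
  obtain ⟨z₁, hz₁⟩ := D.exists_pairingSum_prepend_ne_zero hn u₀
  refine ⟨fun z => G z * pairingSum n A B (prepend u₀ z), hG.mul hP,
    exists_mul_ne_zero hG hP hG0 hz₁, fun z hz f hf h3 hfz hfz' => ?_⟩
  obtain ⟨hGz, hPz⟩ := mul_ne_zero_iff.1 hz
  obtain ⟨hQ, hQ3, hQz, hQz'⟩ := D.pairingSum_prepend hn z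
  refine ⟨f u₀ / pairingSum n A B (prepend u₀ z), fun u => ?_⟩
  set C := f u₀ / pairingSum n A B (prepend u₀ z) with hC
  let g : ℂ → ℂ := fun u => f u + -C * pairingSum n A B (prepend u z)
  have hg := (hf.add (hQ.const_mul (-C))).comp_sub (-((∑ i, z i) / (2 * n - 1 : ℕ)))
  have hg3 := (h3.add (hQ3.const_mul (-C))).comp_add ((∑ i, z i) / (2 * n - 1 : ℕ))
  have e : (3 * ∑ i, z i + 3 * (2 * n - 1 : ℕ) * -((∑ i, z i) / (2 * n - 1 : ℕ)) : ℂ) = 0 := by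
    field_simp; ring
  rw [e] at hg
  simp only [sub_neg_eq_add] at hg
  have h := hGV z hGz (fun u => g (u + (∑ i, z i) / (2 * n - 1 : ℕ))) ⟨hg, hg3⟩ (by
    rintro (j | j | j) <;> simp only [pt, Sum.elim_inl, Sum.elim_inr, sub_add_cancel, g]
    · rw [hfz, hQz]; ring
    · rw [hfz', hQz']; ring
    · rw [hC]; field_simp; ring)
  have := congrFun h (u - (∑ i, z i) / (2 * n - 1 : ℕ))
  simp only [sub_add_cancel, g, Pi.zero_apply] at this
  linear_combination this

end ThetaPair

/-! ### The numerators and prefactors as functions of the additive variable -/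

/-- The numerator as a function of `v`, where `r = exp (π i v)`. -/
noncomputable def numeratorExp (σ : Label) (τ v : ℂ) : ℂ :=
  numerator σ τ (exp (Real.pi * I * v))

/-- The prefactor as a function of `v`, where `r = exp (π i v)`. -/
noncomputable def prefactorExp (σ : Label) (τ v : ℂ) : ℂ :=
  prefactor σ τ (exp (Real.pi * I * v))

theorem norm_nome_two_lt_one {τ : ℂ} (hτ : 0 < τ.im) : ‖nome τ 2‖ < 1 := by
  exact_mod_cast norm_nome_lt_one hτ (c := 2) (by norm_num)

theorem norm_nome_two_thirds_lt_one {τ : ℂ} (hτ : 0 < τ.im) : ‖nome τ (2 / 3)‖ < 1 := by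
  have := norm_nome_lt_one hτ (c := 2 / 3) (by norm_num)
  push_cast at this
  exact this

theorem Label.hatSign_eq (σ : Label) : σ.hatSign = 1 ∨ σ.hatSign = -1 := by
  cases σ <;> simp [Label.hatSign]

/-- The two shapes of the numerator, with the corresponding signs. -/
theorem numerator_cases (σ : Label) (τ : ℂ) :
    (periodSign σ = 1 ∧ quasiPeriodSign σ = σ.hatSign ∧ ∀ r, numerator σ τ r =
      r⁻¹ ^ 2 * (theta (r ^ 2) (nome τ 2) * theta (-r ^ 2) (nome τ 2) *
        theta (σ.hatSign * nome τ 1 * r ^ 2) (nome τ 2))) ∨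
    (periodSign σ = -1 ∧ quasiPeriodSign σ = 1 ∧ ∀ r, numerator σ τ r =
      r⁻¹ * (theta (r ^ 2) (nome τ 2) * theta (1 * nome τ 1 * r ^ 2) (nome τ 2) *
        theta (-1 * nome τ 1 * r ^ 2) (nome τ 2))) := by
  cases σ <;> simp [periodSign, quasiPeriodSign, Label.hatSign, numerator, tripleTheta]

theorem periodSign_eq (σ : Label) : periodSign σ = 1 ∨ periodSign σ = -1 := by
  cases σ <;> simp [periodSign]

theorem quasiPeriodSign_eq (σ : Label) : quasiPeriodSign σ = 1 ∨ quasiPeriodSign σ = -1 := by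
  cases σ <;> simp [quasiPeriodSign]

theorem sign_ne (σ : Label) : ¬ (periodSign σ = -1 ∧ quasiPeriodSign σ = -1) := by
  cases σ <;> norm_num [periodSign, quasiPeriodSign]

theorem differentiable_numeratorExp (σ : Label) {τ : ℂ} (hτ : 0 < τ.im) :
    Differentiable ℂ (numeratorExp σ τ) := by
  have hq := norm_nome_two_lt_one hτ
  have hinv : Differentiable ℂ (fun v : ℂ => (exp (Real.pi * I * v))⁻¹) := by
    simp_rw [← exp_neg]; fun_prop
  have hth : ∀ c : ℂ, c ≠ 0 →
      Differentiable ℂ (fun v : ℂ => theta (c * exp (Real.pi * I * v) ^ 2) (nome τ 2)) :=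
    fun c hc => differentiable_theta_comp hq (by fun_prop) fun v => by simp [hc, exp_ne_zero]
  have h1 := hth 1 one_ne_zero
  have h2 := hth (-1) (by simp)
  have h3 : ∀ s : ℂ, s ≠ 0 → _ := fun s hs => hth (s * nome τ 1) (mul_ne_zero hs (nome_ne_zero _ _))
  simp only [one_mul, neg_mul] at h1 h2
  unfold numeratorExp
  rcases numerator_cases σ τ with ⟨-, -, h⟩ | ⟨-, -, h⟩ <;> simp only [h]
  · exact (hinv.pow 2).mul ((h1.mul h2).mul (h3 _ σ.hatSign_ne_zero))
  · exact hinv.mul ((h1.mul (h3 1 one_ne_zero)).mul (h3 (-1) (by simp)))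

theorem numerator_inv (σ : Label) {τ r : ℂ} (hτ : 0 < τ.im) (hr : r ≠ 0) :
    numerator σ τ r⁻¹ = -numerator σ τ r := by
  have hq := norm_nome_two_lt_one hτ
  have hh : ∀ s : ℂ, s * s = 1 → theta (s * nome τ 1 * (r⁻¹) ^ 2) (nome τ 2) =
      theta (s * nome τ 1 * r ^ 2) (nome τ 2) := fun s hs => by
    rw [inv_pow]; exact theta_half hs (pow_ne_zero _ hr) (by norm_num)
  have h1 : theta (r⁻¹ ^ 2) (nome τ 2) = -(r ^ 2)⁻¹ * theta (r ^ 2) (nome τ 2) := by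
    rw [inv_pow]; exact theta_inv (pow_ne_zero _ hr) hq
  have h2 : theta (-r⁻¹ ^ 2) (nome τ 2) = (r ^ 2)⁻¹ * theta (-r ^ 2) (nome τ 2) := by
    rw [inv_pow, ← inv_neg, theta_inv (by simpa using hr) hq, inv_neg, neg_neg]
  rcases numerator_cases σ τ with ⟨-, -, h⟩ | ⟨-, -, h⟩ <;> rw [h, h]
  · rw [hh _ σ.hatSign_mul_self, h1, h2]
    field_simp
  · rw [hh 1 (by ring), hh (-1) (by ring), h1]
    field_simp

theorem numeratorExp_neg (σ : Label) {τ : ℂ} (hτ : 0 < τ.im) (v : ℂ) :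
    numeratorExp σ τ (-v) = -numeratorExp σ τ v := by
  rw [numeratorExp, numeratorExp, ← numerator_inv σ hτ (exp_ne_zero _), ← exp_neg, mul_neg]

theorem prefactorExp_neg (σ : Label) {τ : ℂ} (hτ : 0 < τ.im) (v : ℂ) :
    prefactorExp σ τ (-v) = prefactorExp σ τ v := by
  rw [prefactorExp, prefactorExp, mul_neg, exp_neg, prefactor_inv σ hτ (exp_ne_zero _)]

theorem exp_pi_mul_add_one (v : ℂ) :
    exp (Real.pi * I * (v + 1)) = -exp (Real.pi * I * v) := by
  rw [mul_add, mul_one, exp_add, exp_pi_mul_I, mul_neg_one]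

theorem exp_pi_mul_add_mul (τ v c : ℂ) :
    exp (Real.pi * I * (v + c * τ)) = nome τ c * exp (Real.pi * I * v) := by
  rw [nome, ← exp_add]; ring_nf

theorem nome_pow (τ c : ℂ) (k : ℕ) : nome τ c ^ k = nome τ (k * c) := by
  rw [nome, nome, ← exp_nat_mul]; ring_nf

theorem exp_quasi_period (τ v : ℂ) : exp (-(Real.pi * I * (3 * (2 * v + τ) - 2 * 0))) =
    (nome τ 1)⁻¹ ^ 3 * (exp (Real.pi * I * v))⁻¹ ^ 6 := by
  rw [nome, ← exp_neg, ← exp_neg, ← exp_nat_mul, ← exp_nat_mul, ← exp_add]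
  push_cast; ring_nf

theorem isTheta_numeratorExp (σ : Label) {τ : ℂ} (hτ : 0 < τ.im) :
    IsTheta τ (periodSign σ) (quasiPeriodSign σ) 3 0 (numeratorExp σ τ) where
  entire := differentiable_numeratorExp σ hτ
  add_one v := by
    rw [numeratorExp, numeratorExp, exp_pi_mul_add_one]
    rcases numerator_cases σ τ with ⟨h1, -, h⟩ | ⟨h1, -, h⟩ <;> rw [h, h, h1] <;>
      simp [even_two.neg_pow, inv_neg]
  add_tau v := by
    have hq := norm_nome_two_lt_one hτ
    have hr := exp_ne_zero (Real.pi * I * v)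
    have e := exp_pi_mul_add_mul τ v 1
    rw [one_mul] at e
    rw [numeratorExp, numeratorExp, e, exp_quasi_period]
    generalize exp (Real.pi * I * v) = r at hr ⊢
    have hp := nome_ne_zero τ 1
    have hq0 := nome_ne_zero τ 2
    have h2 : (nome τ 1 * r) ^ 2 = nome τ 2 * r ^ 2 := by
      rw [mul_pow, nome_pow]; norm_num
    have h3 : -(nome τ 2 * r ^ 2) = nome τ 2 * (-r ^ 2) := by ring
    have h4 : ∀ s : ℂ, s * nome τ 1 * (nome τ 2 * r ^ 2) = nome τ 2 * (s * nome τ 1 * r ^ 2) :=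
      fun s => by ring
    have hs := σ.hatSign_ne_zero
    have hss := σ.hatSign_mul_self
    have hr2 := pow_ne_zero 2 hr
    rcases numerator_cases σ τ with ⟨-, h1, h⟩ | ⟨-, h1, h⟩ <;> rw [h, h, h1, h2] <;>
      simp only [h3, h4]
    · rw [theta_mul_left hr2 hq0 hq, theta_mul_left (neg_ne_zero.2 hr2) hq0 hq,
        theta_mul_left (mul_ne_zero (mul_ne_zero hs hp) hr2) hq0 hq]
      have hsi : (σ.hatSign)⁻¹ = σ.hatSign := inv_eq_of_mul_eq_one_left hss
      simp only [mul_inv, hsi]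
      field_simp
    · rw [theta_mul_left hr2 hq0 hq,
        theta_mul_left (mul_ne_zero (mul_ne_zero one_ne_zero hp) hr2) hq0 hq,
        theta_mul_left (mul_ne_zero (mul_ne_zero (by simp) hp) hr2) hq0 hq]
      field_simp

theorem theta_ne_zero_of_norm_eq_one {x q : ℂ} (hq : ‖q‖ < 1) (hx : ‖x‖ = 1)
    (hx1 : x ≠ 1) : theta x q ≠ 0 := by
  have hx0 : x ≠ 0 := norm_ne_zero_iff.1 (by simp [hx])
  intro h
  obtain ⟨k, hk⟩ := exists_zpow_of_theta_eq_zero hx0 hq h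
  rcases eq_or_ne q 0 with rfl | hq0
  · rcases eq_or_ne k 0 with rfl | hk0
    · simp [hx1] at hk
    · rw [zero_zpow _ hk0] at hk; exact hx0 hk
  have : ‖q‖ ^ k = 1 := by rw [← norm_zpow, ← hk, hx]
  rw [zpow_eq_one_iff_right₀ (norm_nonneg _) hq.ne] at this
  rw [this, zpow_zero] at hk
  exact hx1 hk

/-- If `|x| = 1`, then `x p ^ c` is no integer power of `p ^ (2 c)`, as its modulus is an odd power
of `|p ^ c|`. -/
theorem theta_half_ne_zero {τ : ℂ} (hτ : 0 < τ.im) {x : ℂ} {c : ℝ} (hc : 0 < c) (hx : ‖x‖ = 1) :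
    theta (x * nome τ c) (nome τ (2 * c)) ≠ 0 := by
  intro h
  have hq : ‖nome τ (2 * c)‖ < 1 := by
    exact_mod_cast norm_nome_lt_one hτ (c := 2 * c) (by positivity)
  obtain ⟨k, hk⟩ := exists_zpow_of_theta_eq_zero (mul_ne_zero (norm_ne_zero_iff.1 (by simp [hx]))
    (nome_ne_zero _ _)) hq h
  have h2 : nome τ (2 * c) = nome τ c ^ (2 : ℤ) := by
    rw [zpow_ofNat, nome_pow]; norm_num
  have hn := congrArg norm hk
  rw [h2, ← zpow_mul, norm_mul, hx, one_mul, norm_zpow] at hn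
  have h1 : ‖nome τ c‖ ^ (2 * k - 1) = 1 := by
    have : ‖nome τ c‖ ≠ 0 := norm_ne_zero_iff.2 (nome_ne_zero _ _)
    rw [zpow_sub₀ this, ← hn, zpow_one, div_self this]
  rw [zpow_eq_one_iff_right₀ (norm_nonneg _) (norm_nome_lt_one hτ hc).ne] at h1
  omega

theorem numeratorExp_quarter_ne_zero (σ : Label) {τ : ℂ} (hτ : 0 < τ.im) :
    numeratorExp σ τ (1 / 4) ≠ 0 := by
  have hq := norm_nome_two_lt_one hτ
  have e : exp (Real.pi * I * (1 / 4)) ^ 2 = I := by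
    rw [← exp_nat_mul, show ((2 : ℕ) : ℂ) * (Real.pi * I * (1 / 4)) = Real.pi / 2 * I by
      push_cast; ring, exp_pi_div_two_mul_I]
  have h1 : theta I (nome τ 2) ≠ 0 := theta_ne_zero_of_norm_eq_one hq (by simp) (by
    intro h; simpa using congrArg Complex.re h)
  have h2 : theta (-I) (nome τ 2) ≠ 0 := theta_ne_zero_of_norm_eq_one hq (by simp) (by
    intro h; simpa using congrArg Complex.re h)
  have h3 : ∀ s : ℂ, (s = 1 ∨ s = -1) → theta (s * nome τ 1 * I) (nome τ 2) ≠ 0 := fun s hs => by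
    have := theta_half_ne_zero hτ (x := s * I) (c := 1) one_pos
      (by rw [norm_mul, norm_eq_one_of_sign hs]; simp)
    rwa [ofReal_one, mul_one, mul_right_comm] at this
  unfold numeratorExp
  rcases numerator_cases σ τ with ⟨-, -, h⟩ | ⟨-, -, h⟩ <;> rw [h, e]
  · exact mul_ne_zero (pow_ne_zero _ (inv_ne_zero (exp_ne_zero _)))
      (mul_ne_zero (mul_ne_zero h1 h2) (h3 _ σ.hatSign_eq))
  · exact mul_ne_zero (inv_ne_zero (exp_ne_zero _))
      (mul_ne_zero (mul_ne_zero h1 (h3 _ (Or.inl rfl))) (h3 _ (Or.inr rfl)))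

/-- The labels with a three-term relation for the shift `2 / 3`; the other ones have a three-term
relation for the shift `2 τ / 3`. -/
def Label.IsReal : Label → Prop
  | .s1 | .h1 | .s2 | .h2 | .s4 | .h4 => True
  | .s0 | .h0 | .s3 | .h3 | .s6 | .h6 => False

/-- The two shapes of the prefactor for the shift `2 / 3`, with the half-period. -/
theorem prefactor_cases_of_isReal {σ : Label} (h : σ.IsReal) (τ : ℂ) :
    (halfPeriod τ σ = 1 / 2 ∧ periodSign σ = 1 ∧
      ∀ r, prefactor σ τ r = r⁻¹ ^ 3 * theta (-r ^ 6) (nome τ 6)) ∨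
    ((halfPeriod τ σ = τ / 2 ∧ σ.hatSign = 1 ∨ halfPeriod τ σ = (1 + τ) / 2 ∧ σ.hatSign = -1) ∧
      ∀ r, prefactor σ τ r = theta (σ.hatSign * nome τ 3 * r ^ 6) (nome τ 6)) := by
  cases σ <;> simp_all [Label.IsReal, halfPeriod, Label.hatSign, prefactor, periodSign]

/-- The two shapes of the prefactor for the shift `2 τ / 3`, with the half-period. -/
theorem prefactor_cases_of_not_isReal {σ : Label} (h : ¬ σ.IsReal) (τ : ℂ) :
    (halfPeriod τ σ = 1 / 2 ∧ periodSign σ = 1 ∧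
      ∀ r, prefactor σ τ r = r⁻¹ * theta (-r ^ 2) (nome τ (2 / 3))) ∨
    ((halfPeriod τ σ = τ / 2 ∧ σ.hatSign = 1 ∨ halfPeriod τ σ = (1 + τ) / 2 ∧ σ.hatSign = -1) ∧
      ∀ r, prefactor σ τ r = theta (σ.hatSign * nome τ (1 / 3) * r ^ 2) (nome τ (2 / 3))) := by
  cases σ <;> simp_all [Label.IsReal, halfPeriod, Label.hatSign, prefactor, periodSign]

theorem exp_half_sq : exp (Real.pi * I * (1 / 2)) ^ 2 = -1 := by
  rw [← exp_nat_mul, ← exp_pi_mul_I]; push_cast; ring_nf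

theorem exp_halfPeriod_sq {σ : Label} {τ : ℂ}
    (h : halfPeriod τ σ = τ / 2 ∧ σ.hatSign = 1 ∨ halfPeriod τ σ = (1 + τ) / 2 ∧ σ.hatSign = -1) :
    exp (Real.pi * I * halfPeriod τ σ) ^ 2 = σ.hatSign * nome τ 1 := by
  rcases h with ⟨h1, h2⟩ | ⟨h1, h2⟩ <;> rw [h1, h2, ← exp_nat_mul, nome]
  · rw [one_mul]; push_cast; ring_nf
  · rw [← exp_pi_mul_I, ← exp_add]; push_cast; ring_nf

theorem numeratorExp_halfPeriod (σ : Label) {τ : ℂ} (hτ : 0 < τ.im) :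
    numeratorExp σ τ (halfPeriod τ σ) = 0 := by
  have hq := norm_nome_two_lt_one hτ
  have h11 : nome τ 1 * nome τ 1 = nome τ 2 := by rw [nome_mul]; norm_num
  have hcase : halfPeriod τ σ = 1 / 2 ∧ periodSign σ = 1 ∨
      (halfPeriod τ σ = τ / 2 ∧ σ.hatSign = 1 ∨ halfPeriod τ σ = (1 + τ) / 2 ∧ σ.hatSign = -1) := by
    by_cases h : σ.IsReal
    · exact (prefactor_cases_of_isReal h τ).imp (fun h => ⟨h.1, h.2.1⟩) fun h => h.1
    · exact (prefactor_cases_of_not_isReal h τ).imp (fun h => ⟨h.1, h.2.1⟩) fun h => h.1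
  unfold numeratorExp
  rcases hcase with ⟨h1, hp⟩ | h1
  · rcases numerator_cases σ τ with ⟨-, -, h⟩ | ⟨hp', -, -⟩
    · rw [h, h1, exp_half_sq, neg_neg, theta_one hq]; ring
    · rw [hp] at hp'; norm_num at hp'
  · have h2 := exp_halfPeriod_sq h1
    have hself : σ.hatSign * nome τ 1 * (σ.hatSign * nome τ 1) = nome τ 2 := by
      rw [← h11]; linear_combination nome τ 1 ^ 2 * σ.hatSign_mul_self
    rcases numerator_cases σ τ with ⟨-, -, h⟩ | ⟨-, -, h⟩ <;> rw [h, h2]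
    · rw [hself, theta_self (nome_ne_zero _ _) hq]; ring
    · rcases h1 with ⟨-, hs⟩ | ⟨-, hs⟩ <;> rw [hs] at hself ⊢ <;>
        rw [hself, theta_self (nome_ne_zero _ _) hq] <;> ring

/-- For the shift `2 / 3`, the numerator and the prefactor form a pair as required. -/
theorem exists_thetaPair_of_isReal {σ : Label} (hσ : σ.IsReal) {τ : ℂ} (hτ : 0 < τ.im) :
    ∃ (β₁ β₂ : ℂ) (a b : ℤ), halfPeriod τ σ = (a + b * τ) / 2 ∧
      ThetaPair τ (periodSign σ) (quasiPeriodSign σ) β₁ β₂ a b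
        (numeratorExp σ τ) (prefactorExp σ τ) := by
  have hq := norm_nome_six_lt_one hτ
  have hq0 := nome_ne_zero τ 6
  have hA0 := numeratorExp_halfPeriod σ hτ
  have e3 : ∀ v : ℂ, exp (Real.pi * I * (v + 1 / 3)) ^ 3 = -exp (Real.pi * I * v) ^ 3 := fun v => by
    rw [← exp_nat_mul, ← exp_nat_mul, ← exp_add_pi_mul_I]; push_cast; ring_nf
  have e6 : ∀ v : ℂ, exp (Real.pi * I * (v + 1 / 3)) ^ 6 = exp (Real.pi * I * v) ^ 6 := fun v => by
    rw [show 6 = 3 * 2 from rfl, pow_mul, e3, pow_mul]; ring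
  have eτ : ∀ v : ℂ, exp (Real.pi * I * (v + τ)) = nome τ 1 * exp (Real.pi * I * v) := fun v => by
    have := exp_pi_mul_add_mul τ v 1
    rwa [one_mul] at this
  have e16 : ∀ r : ℂ, (nome τ 1 * r) ^ 6 = nome τ 6 * r ^ 6 := fun r => by
    rw [mul_pow, nome_pow]; norm_num
  have hinv : Differentiable ℂ (fun v : ℂ => (exp (Real.pi * I * v))⁻¹) := by
    simp_rw [← exp_neg]; fun_prop
  have hone : ∀ {f : ℂ → ℂ} {β : ℂ}, (β = 1 ∨ β = -1) → (∀ v, f (v + 1 / 3) = β * f v) →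
      ∀ v, f (v + 1) = β * f v := fun {f β} hβ h v => by
    rw [show v + 1 = v + 1 / 3 + 1 / 3 + 1 / 3 by ring, h, h, h]
    linear_combination β * f v * mul_self_of_sign hβ
  rcases prefactor_cases_of_isReal hσ τ with ⟨hω, -, hB⟩ | ⟨hω, hB⟩
  · have hthird : ∀ v, prefactorExp σ τ (v + 1 / 3) = -1 * prefactorExp σ τ v := fun v => by
      rw [prefactorExp, prefactorExp, hB, hB, e6, inv_pow, e3]; ring
    have hhalf : halfPeriod τ σ = ((1 : ℤ) + (0 : ℤ) * τ) / 2 := by rw [hω]; push_cast; ring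
    refine ⟨-1, 1, 1, 0, hhalf, hτ, periodSign_eq σ, quasiPeriodSign_eq σ, Or.inr rfl, Or.inl rfl,
      sign_ne σ, by decide, isTheta_numeratorExp σ hτ, numeratorExp_neg σ hτ, hhalf ▸ hA0,
      ⟨_, numeratorExp_quarter_ne_zero σ hτ⟩, ⟨?_, hone (Or.inr rfl) hthird, fun v => ?_⟩, hthird,
      prefactorExp_neg σ hτ, ?_, ⟨0, ?_⟩⟩
    · unfold prefactorExp
      simp only [hB]
      exact (hinv.pow 3).mul (differentiable_theta_comp hq (by fun_prop) fun v => by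
        simp [exp_ne_zero])
    · have hr := exp_ne_zero (Real.pi * I * v)
      rw [prefactorExp, prefactorExp, hB, hB, eτ, exp_quasi_period, e16]
      generalize exp (Real.pi * I * v) = r at hr ⊢
      have hp := nome_ne_zero τ 1
      rw [show -(nome τ 6 * r ^ 6) = nome τ 6 * -r ^ 6 by ring,
        theta_mul_left (by simpa using hr) hq0 hq]
      field_simp
    · rw [← hhalf, prefactorExp, hB, hω, show 6 = 2 * 3 from rfl, pow_mul, exp_half_sq,
        show (-(-1) ^ 3 : ℂ) = 1 by norm_num, theta_one hq, mul_zero]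
    · rw [prefactorExp, hB]
      simpa using theta_ne_zero_of_norm_eq_one hq (x := -1) (by simp) (by norm_num)
  · have hs := σ.hatSign_ne_zero
    have hp3 := nome_ne_zero τ 3
    have hthird : ∀ v, prefactorExp σ τ (v + 1 / 3) = 1 * prefactorExp σ τ v := fun v => by
      rw [prefactorExp, prefactorExp, hB, hB, e6, one_mul]
    obtain ⟨a, hhalf⟩ : ∃ a : ℤ, halfPeriod τ σ = (a + (1 : ℤ) * τ) / 2 := by
      rcases hω with ⟨h, -⟩ | ⟨h, -⟩
      · exact ⟨0, by rw [h]; push_cast; ring⟩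
      · exact ⟨1, by rw [h]; push_cast; ring⟩
    refine ⟨1, -σ.hatSign, a, 1, hhalf, hτ, periodSign_eq σ, quasiPeriodSign_eq σ, Or.inl rfl, ?_,
      sign_ne σ, by simp, isTheta_numeratorExp σ hτ, numeratorExp_neg σ hτ, hhalf ▸ hA0,
      ⟨_, numeratorExp_quarter_ne_zero σ hτ⟩, ⟨?_, hone (Or.inl rfl) hthird, fun v => ?_⟩, hthird,
      prefactorExp_neg σ hτ, ?_, ⟨0, ?_⟩⟩
    · rcases σ.hatSign_eq with h | h <;> simp [h]
    · unfold prefactorExp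
      simp only [hB]
      exact differentiable_theta_comp hq (by fun_prop) fun v => by
        simp [exp_ne_zero, hs, hp3]
    · have hr := exp_ne_zero (Real.pi * I * v)
      rw [prefactorExp, prefactorExp, hB, hB, eτ, exp_quasi_period, e16]
      generalize exp (Real.pi * I * v) = r at hr ⊢
      have hsi : (σ.hatSign)⁻¹ = σ.hatSign := inv_eq_of_mul_eq_one_left σ.hatSign_mul_self
      rw [show σ.hatSign * nome τ 3 * (nome τ 6 * r ^ 6) =
        nome τ 6 * (σ.hatSign * nome τ 3 * r ^ 6) by ring,
        theta_mul_left (mul_ne_zero (mul_ne_zero hs hp3) (pow_ne_zero _ hr)) hq0 hq,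
        mul_inv, mul_inv, hsi, show (nome τ 1)⁻¹ ^ 3 = (nome τ 3)⁻¹ by
          rw [inv_pow, nome_pow]; norm_num]
      ring
    · rw [← hhalf, prefactorExp, hB, show 6 = 2 * 3 from rfl, pow_mul, exp_halfPeriod_sq hω,
        show σ.hatSign * nome τ 3 * (σ.hatSign * nome τ 1) ^ 3 = nome τ 3 * nome τ 1 ^ 3 *
          (σ.hatSign * σ.hatSign) ^ 2 by ring, σ.hatSign_mul_self, nome_pow, nome_mul]
      norm_num
      exact theta_self hq0 hq
    · rw [prefactorExp, hB]
      have := theta_half_ne_zero hτ (x := σ.hatSign) (c := 3) (by norm_num)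
        (norm_eq_one_of_sign σ.hatSign_eq)
      norm_num at this ⊢
      exact this

/-! ### The modular transformation -/

/-- The transform `w ↦ exp (π i (τ N w² - 2 S w)) f (τ w)` of a theta function of degree `N`
and center `S`. -/
noncomputable def modularTransform (τ N S : ℂ) (f : ℂ → ℂ) (w : ℂ) : ℂ :=
  exp (Real.pi * I * (τ * N * w ^ 2 - 2 * S * w)) * f (τ * w)

/-- The modular transformation `τ ↦ -1/τ` interchanges the two characters. -/
theorem IsTheta.modularTransform {τ c₁ c₂ N S : ℂ} {f : ℂ → ℂ} (hf : IsTheta τ c₁ c₂ N S f)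
    (hτ : τ ≠ 0) (hc₁ : c₁ = 1 ∨ c₁ = -1) :
    IsTheta (-1 / τ) c₂ c₁ N (S / τ) (modularTransform τ N S f) where
  entire := by
    unfold EllipticPfaffian.modularTransform
    exact Differentiable.mul (by fun_prop) (hf.entire.comp (by fun_prop))
  add_one w := by
    rw [EllipticPfaffian.modularTransform, EllipticPfaffian.modularTransform,
      show τ * (w + 1) = τ * w + τ by ring, hf.add_tau,
      show Real.pi * I * (τ * N * (w + 1) ^ 2 - 2 * S * (w + 1)) =
        Real.pi * I * (τ * N * w ^ 2 - 2 * S * w) +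
          Real.pi * I * (N * (2 * (τ * w) + τ) - 2 * S) by ring, exp_add, exp_neg]
    have := exp_ne_zero (Real.pi * I * (N * (2 * (τ * w) + τ) - 2 * S))
    field_simp
  add_tau w := by
    have h1 : f (τ * (w + -1 / τ)) = c₁ * f (τ * w) := by
      have := hf.add_one (τ * (w + -1 / τ))
      rw [show τ * (w + -1 / τ) + 1 = τ * w by field_simp; ring] at this
      rw [this, ← mul_assoc, mul_self_of_sign hc₁, one_mul]
    rw [EllipticPfaffian.modularTransform, EllipticPfaffian.modularTransform, h1,
      show Real.pi * I * (τ * N * (w + -1 / τ) ^ 2 - 2 * S * (w + -1 / τ)) =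
        -(Real.pi * I * (N * (2 * w + -1 / τ) - 2 * (S / τ))) +
          Real.pi * I * (τ * N * w ^ 2 - 2 * S * w) by field_simp; ring, exp_add]
    ring

theorem im_neg_one_div_pos {τ : ℂ} (hτ : 0 < τ.im) : 0 < (-1 / τ).im := by
  rw [neg_div, one_div, neg_im, inv_im, neg_div, neg_neg]
  exact div_pos hτ (normSq_pos.2 fun h => by simp [h] at hτ)

/-- For the shift `2 τ / 3`, the modular transforms of the numerator and the prefactor form a pair
as required. -/
theorem exists_thetaPair_of_not_isReal {σ : Label} (hσ : ¬ σ.IsReal) {τ : ℂ} (hτ : 0 < τ.im) :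
    ∃ (β₁ β₂ : ℂ) (a b : ℤ), halfPeriod τ σ / τ = (a + b * (-1 / τ)) / 2 ∧
      ThetaPair (-1 / τ) (quasiPeriodSign σ) (periodSign σ) β₁ β₂ a b
        (modularTransform τ 3 0 (numeratorExp σ τ))
        (modularTransform τ 3 0 (prefactorExp σ τ)) := by
  have hq := norm_nome_two_thirds_lt_one hτ
  have hq0 := nome_ne_zero τ (2 / 3)
  have hτ0 : τ ≠ 0 := fun h => by simp [h] at hτ
  have hz : ∀ f : ℂ → ℂ, f (halfPeriod τ σ) = 0 →
      modularTransform τ 3 0 f (halfPeriod τ σ / τ) = 0 := fun f hf => by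
    rw [modularTransform, mul_div_cancel₀ _ hτ0, hf, mul_zero]
  have hA0 := hz _ (numeratorExp_halfPeriod σ hτ)
  have hA := (isTheta_numeratorExp σ hτ).modularTransform hτ0 (periodSign_eq σ)
  rw [zero_div] at hA
  have hAodd : ∀ w, modularTransform τ 3 0 (numeratorExp σ τ) (-w) =
      -modularTransform τ 3 0 (numeratorExp σ τ) w := fun w => by
    simp only [modularTransform, mul_neg, numeratorExp_neg σ hτ]
    ring_nf
  have hBeven : ∀ w, modularTransform τ 3 0 (prefactorExp σ τ) (-w) =
      modularTransform τ 3 0 (prefactorExp σ τ) w := fun w => by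
    simp only [modularTransform, mul_neg, prefactorExp_neg σ hτ]
    ring_nf
  have hAne : ∃ w, modularTransform τ 3 0 (numeratorExp σ τ) w ≠ 0 := by
    refine ⟨1 / 4 / τ, ?_⟩
    rw [modularTransform, mul_div_cancel₀ _ hτ0]
    exact mul_ne_zero (exp_ne_zero _) (numeratorExp_quarter_ne_zero σ hτ)
  -- the period `τ / 3` of `B` becomes the period `1 / 3` of its transform
  have hthird' : ∀ {β : ℂ}, (∀ v, prefactorExp σ τ (v + 1 / 3 * τ) =
      β * (nome τ (1 / 3))⁻¹ * (exp (Real.pi * I * v) ^ 2)⁻¹ * prefactorExp σ τ v) →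
      ∀ w, modularTransform τ 3 0 (prefactorExp σ τ) (w + 1 / 3) =
        β * modularTransform τ 3 0 (prefactorExp σ τ) w := fun {β} h w => by
    rw [modularTransform, modularTransform, show τ * (w + 1 / 3) = τ * w + 1 / 3 * τ by ring, h,
      show Real.pi * I * (τ * 3 * (w + 1 / 3) ^ 2 - 2 * 0 * (w + 1 / 3)) =
        Real.pi * I * (τ * 3 * w ^ 2 - 2 * 0 * w) +
          (Real.pi * I * τ * (1 / 3) + (2 : ℕ) * (Real.pi * I * (τ * w))) by push_cast; ring,
      exp_add, exp_add _ ((2 : ℕ) * _), exp_nat_mul, nome]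
    have h1 := exp_ne_zero (Real.pi * I * τ * (1 / 3))
    have h2 := exp_ne_zero (Real.pi * I * (τ * w))
    field_simp
  have hB' : ∀ {β₁ β₂ : ℂ}, (β₁ = 1 ∨ β₁ = -1) → (β₂ = 1 ∨ β₂ = -1) →
      Differentiable ℂ (prefactorExp σ τ) →
      (∀ w, modularTransform τ 3 0 (prefactorExp σ τ) (w + 1 / 3) =
        β₁ * modularTransform τ 3 0 (prefactorExp σ τ) w) →
      (∀ v, prefactorExp σ τ (v + 1) = β₂ * prefactorExp σ τ v) →
      IsTheta (-1 / τ) β₁ β₂ 3 0 (modularTransform τ 3 0 (prefactorExp σ τ)) := by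
    intro β₁ β₂ hβ₁ hβ₂ hd h1 h2
    refine ⟨?_, fun w => ?_, fun w => ?_⟩
    · unfold modularTransform
      exact Differentiable.mul (by fun_prop) (hd.comp (by fun_prop))
    · rw [show w + 1 = w + 1 / 3 + 1 / 3 + 1 / 3 by ring, h1, h1, h1]
      linear_combination β₁ * modularTransform τ 3 0 (prefactorExp σ τ) w * mul_self_of_sign hβ₁
    · have h3 : prefactorExp σ τ (τ * (w + -1 / τ)) = β₂ * prefactorExp σ τ (τ * w) := by
        have := h2 (τ * (w + -1 / τ))
        rw [show τ * (w + -1 / τ) + 1 = τ * w by field_simp; ring] at this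
        rw [this, ← mul_assoc, mul_self_of_sign hβ₂, one_mul]
      rw [modularTransform, modularTransform, h3,
        show Real.pi * I * (τ * 3 * (w + -1 / τ) ^ 2 - 2 * 0 * (w + -1 / τ)) =
          -(Real.pi * I * (3 * (2 * w + -1 / τ) - 2 * 0)) +
            Real.pi * I * (τ * 3 * w ^ 2 - 2 * 0 * w) by field_simp; ring, exp_add]
      ring
  have e2 : ∀ v : ℂ, exp (Real.pi * I * (v + 1 / 3 * τ)) ^ 2 =
      nome τ (2 / 3) * exp (Real.pi * I * v) ^ 2 := fun v => by
    rw [exp_pi_mul_add_mul, mul_pow, nome_pow]; norm_num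
  have hinv : Differentiable ℂ (fun v : ℂ => (exp (Real.pi * I * v))⁻¹) := by
    simp_rw [← exp_neg]; fun_prop
  have hBne : prefactorExp σ τ 0 ≠ 0 → ∃ w, modularTransform τ 3 0 (prefactorExp σ τ) w ≠ 0 :=
    fun h => ⟨0, by simpa [modularTransform] using h⟩
  rcases prefactor_cases_of_not_isReal hσ τ with ⟨hω, -, hB⟩ | ⟨hω, hB⟩
  · have hthird := hthird' (β := 1) fun v => by
      have hr := exp_ne_zero (Real.pi * I * v)
      have hp := nome_ne_zero τ (1 / 3)
      rw [prefactorExp, prefactorExp, hB, hB, e2, exp_pi_mul_add_mul]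
      generalize exp (Real.pi * I * v) = r at hr ⊢
      rw [show -(nome τ (2 / 3) * r ^ 2) = nome τ (2 / 3) * -r ^ 2 by ring,
        theta_mul_left (by simpa using hr) hq0 hq]
      field_simp
    have hadd : ∀ v, prefactorExp σ τ (v + 1) = -1 * prefactorExp σ τ v := fun v => by
      rw [prefactorExp, prefactorExp, hB, hB, exp_pi_mul_add_one, even_two.neg_pow, inv_neg]; ring
    have hd : Differentiable ℂ (prefactorExp σ τ) := by
      unfold prefactorExp
      simp only [hB]
      exact hinv.mul (differentiable_theta_comp hq (by fun_prop) fun v => by simp [exp_ne_zero])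
    have hhalf : halfPeriod τ σ / τ = ((0 : ℤ) + (-1 : ℤ) * (-1 / τ)) / 2 := by
      rw [hω]; push_cast; field_simp; ring
    have hB0 : prefactorExp σ τ (halfPeriod τ σ) = 0 := by
      rw [prefactorExp, hB, hω, exp_half_sq, neg_neg, theta_one hq, mul_zero]
    exact ⟨1, -1, 0, -1, hhalf, im_neg_one_div_pos hτ, quasiPeriodSign_eq σ, periodSign_eq σ,
      Or.inl rfl, Or.inr rfl, fun h => sign_ne σ h.symm, by decide, hA, hAodd, hhalf ▸ hA0, hAne,
      hB' (Or.inl rfl) (Or.inr rfl) hd hthird hadd, hthird, hBeven, hhalf ▸ hz _ hB0, hBne (by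
        rw [prefactorExp, hB]
        simpa using theta_ne_zero_of_norm_eq_one hq (x := -1) (by simp) (by norm_num))⟩
  · have hs := σ.hatSign_ne_zero
    have hp3 := nome_ne_zero τ (1 / 3)
    have hthird := hthird' (β := -σ.hatSign) fun v => by
      have hr := exp_ne_zero (Real.pi * I * v)
      have hsi : (σ.hatSign)⁻¹ = σ.hatSign := inv_eq_of_mul_eq_one_left σ.hatSign_mul_self
      rw [prefactorExp, prefactorExp, hB, hB, e2]
      generalize exp (Real.pi * I * v) = r at hr ⊢
      rw [show σ.hatSign * nome τ (1 / 3) * (nome τ (2 / 3) * r ^ 2) =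
        nome τ (2 / 3) * (σ.hatSign * nome τ (1 / 3) * r ^ 2) by ring,
        theta_mul_left (mul_ne_zero (mul_ne_zero hs hp3) (pow_ne_zero _ hr)) hq0 hq,
        mul_inv, mul_inv, hsi]
      ring
    have hadd : ∀ v, prefactorExp σ τ (v + 1) = 1 * prefactorExp σ τ v := fun v => by
      rw [prefactorExp, prefactorExp, hB, hB, exp_pi_mul_add_one, even_two.neg_pow, one_mul]
    have hd : Differentiable ℂ (prefactorExp σ τ) := by
      unfold prefactorExp
      simp only [hB]
      exact differentiable_theta_comp hq (by fun_prop) fun v => by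
        exact mul_ne_zero (mul_ne_zero hs hp3) (pow_ne_zero _ (exp_ne_zero _))
    obtain ⟨b, hhalf⟩ : ∃ b : ℤ, halfPeriod τ σ / τ = ((1 : ℤ) + b * (-1 / τ)) / 2 := by
      rcases hω with ⟨h, -⟩ | ⟨h, -⟩
      · exact ⟨0, by rw [h]; push_cast; field_simp; ring⟩
      · exact ⟨-1, by rw [h]; push_cast; field_simp; ring⟩
    have hB0 : prefactorExp σ τ (halfPeriod τ σ) = 0 := by
      have h43 : nome τ (1 / 3) * nome τ 1 = nome τ (2 / 3) * nome τ (2 / 3) := by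
        rw [nome_mul, nome_mul]; norm_num
      rw [prefactorExp, hB, exp_halfPeriod_sq hω,
        show σ.hatSign * nome τ (1 / 3) * (σ.hatSign * nome τ 1) = nome τ (1 / 3) * nome τ 1 *
          (σ.hatSign * σ.hatSign) by ring, σ.hatSign_mul_self, mul_one, h43,
        theta_mul_left hq0 hq0 hq, theta_self hq0 hq, mul_zero]
    have hβ : -σ.hatSign = 1 ∨ -σ.hatSign = -1 := by
      rcases σ.hatSign_eq with h | h <;> simp [h]
    exact ⟨-σ.hatSign, 1, 1, b, hhalf, im_neg_one_div_pos hτ, quasiPeriodSign_eq σ,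
      periodSign_eq σ, hβ, Or.inl rfl, fun h => sign_ne σ h.symm, by simp, hA, hAodd, hhalf ▸ hA0,
      hAne, hB' hβ (Or.inl rfl) hd hthird hadd, hthird, hBeven, hhalf ▸ hz _ hB0, hBne (by
        rw [prefactorExp, hB]
        have := theta_half_ne_zero hτ (x := σ.hatSign) (c := 1 / 3) (by norm_num)
          (norm_eq_one_of_sign σ.hatSign_eq)
        norm_num at this ⊢
        exact this)⟩

/-- The pairing sum of the modular transforms: every pair of indices contributes the same
exponential, whether it is matched or not. -/
theorem pairingSum_modularTransform (n : ℕ) (τ : ℂ) (A B : ℂ → ℂ) (y : Fin (2 * n) → ℂ) :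
    pairingSum n (modularTransform τ 3 0 A) (modularTransform τ 3 0 B) y =
      exp (3 * Real.pi * I * τ *
        ∑ q : Fin (2 * n) × Fin (2 * n) with q.1 < q.2, (y q.1 - y q.2) ^ 2) *
        pairingSum n A B (fun i => τ * y i) := by
  rw [pairingSum, pairingSum, Finset.mul_sum]
  refine Finset.sum_congr rfl fun π _ => ?_
  have h := prod_lt_eq π (fun i j => exp (3 * Real.pi * I * τ * (y i - y j) ^ 2))
    fun i j => by rw [← neg_sub, neg_sq]
  rw [← exp_sum, ← Finset.mul_sum] at h
  have e : ∀ (f : ℂ → ℂ) (x y : ℂ), modularTransform τ 3 0 f (x - y) =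
      exp (3 * Real.pi * I * τ * (x - y) ^ 2) * f (τ * x - τ * y) := fun f x y => by
    rw [modularTransform, mul_sub τ]; ring_nf
  rw [h, pairingTerm, pairingTerm]
  simp only [e, Finset.prod_mul_distrib]
  ring

theorem sum_prepend {n : ℕ} (hn : 0 < n) (g : ℂ → ℂ) (u : ℂ) (z : Fin (2 * n - 1) → ℂ) :
    ∑ i, g (prepend u z i) = g u + ∑ k, g (z k) := by
  obtain ⟨m, rfl⟩ : ∃ m, n = m + 1 := ⟨n - 1, by omega⟩
  exact Fin.sum_univ_succ (n := 2 * m + 1) fun i => g (prepend (n := m + 1) u z i)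

/-- The sum of the squares of the differences, as a function of the first variable. -/
theorem exists_sum_lt_prepend_eq {n : ℕ} (hn : 0 < n) (z : Fin (2 * n - 1) → ℂ) :
    ∃ κ : ℂ, ∀ u, ∑ q : Fin (2 * n) × Fin (2 * n) with q.1 < q.2,
      (prepend u z q.1 - prepend u z q.2) ^ 2 =
        (2 * n - 1 : ℕ) * u ^ 2 - 2 * (∑ i, z i) * u + κ := by
  refine ⟨2 * n * ∑ i, z i ^ 2 - (∑ i, z i) ^ 2, fun u => ?_⟩
  set y := prepend u z
  have hall : ∑ q : Fin (2 * n) × Fin (2 * n), (y q.1 - y q.2) ^ 2 =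
      2 * ∑ q : Fin (2 * n) × Fin (2 * n) with q.1 < q.2, (y q.1 - y q.2) ^ 2 := by
    rw [← Finset.sum_filter_add_sum_filter_not _ (fun q => q.1 < q.2),
      two_mul (∑ q : Fin (2 * n) × Fin (2 * n) with q.1 < q.2, (y q.1 - y q.2) ^ 2)]
    congr 1
    have hsub : ({q | q.2 < q.1} : Finset (Fin (2 * n) × Fin (2 * n))) ⊆
        ({q | ¬ q.1 < q.2} : Finset (Fin (2 * n) × Fin (2 * n))) := fun q hq => by
      simp only [Finset.mem_filter, Finset.mem_univ, true_and] at hq ⊢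
      exact hq.not_gt
    rw [← Finset.sum_subset hsub fun q hq hq' => by
      simp only [Finset.mem_filter, Finset.mem_univ, true_and] at hq hq'
      rw [le_antisymm (not_lt.1 hq') (not_lt.1 hq), sub_self]; ring]
    refine Finset.sum_nbij' Prod.swap Prod.swap ?_ ?_ ?_ ?_ ?_ <;> simp
    intro i j _
    ring
  have hexp : ∑ q : Fin (2 * n) × Fin (2 * n), (y q.1 - y q.2) ^ 2 =
      2 * (2 * n * ∑ i, y i ^ 2 - (∑ i, y i) ^ 2) := by
    rw [Fintype.sum_prod_type]
    simp only [sub_sq, Finset.sum_add_distrib, Finset.sum_sub_distrib, Finset.sum_const,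
      Finset.card_univ, Fintype.card_fin, nsmul_eq_mul, ← Finset.mul_sum, ← Finset.sum_mul]
    push_cast; ring
  have h1 := sum_prepend hn (fun x => x) u z
  have h2 := sum_prepend hn (fun x => x ^ 2) u z
  rw [hexp, h1, h2] at hall
  have hn' : ((2 * n - 1 : ℕ) : ℂ) = 2 * n - 1 := by
    rw [Nat.cast_sub (by omega)]; push_cast; ring
  rw [hn']
  linear_combination -hall / 2

/-! ### The elliptic pfaffians -/

theorem P_eq_pairingSum (n : ℕ) (σ : Label) (z : Fin (2 * n) → ℂ) (τ : ℂ) :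
    P n σ z τ = 1 / (2 ^ n * (n.factorial : ℂ)) *
      pairingSum n (numeratorExp σ τ) (prefactorExp σ τ) z := by
  have h : ∀ i j, xRatio z i j = exp (Real.pi * I * (z i - z j)) := fun i j => by
    rw [xRatio, ← exp_sub, mul_sub]
  simp only [P, pairingSum, pairingTerm, numeratorExp, prefactorExp, h]

theorem IsAdmissible.isTheta {n : ℕ} (hn : 0 < n) {σ : Label} {τ : ℂ} {z : Fin (2 * n - 1) → ℂ}
    {f : ℂ → ℂ} (hf : IsAdmissible n σ τ z f) :
    IsTheta τ (periodSign σ) (quasiPeriodSign σ) (3 * (2 * n - 1 : ℕ)) (3 * ∑ i, z i) f where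
  entire := hf.entire
  add_one := hf.add_one
  add_tau u := by
    have hn' : ((2 * n - 1 : ℕ) : ℂ) = 2 * n - 1 := by
      rw [Nat.cast_sub (by omega)]; push_cast; ring
    rw [hf.add_tau, ← exp_nat_mul, ← exp_sub, hn',
      show -(Real.pi * I * (3 * (2 * n - 1) * (2 * u + τ) - 2 * (3 * ∑ i, z i))) =
        (3 : ℕ) * (2 * Real.pi * I * ∑ i, z i) - (6 * n - 3) * Real.pi * I * (2 * u + τ) by
          push_cast; ring]
    ring

theorem holdsGenerically_of_isReal {n : ℕ} (hn : 0 < n) {σ : Label} (hσ : σ.IsReal) {τ : ℂ}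
    (hτ : 0 < τ.im) :
    HoldsGenerically (fun z : Fin (2 * n - 1) → ℂ => ∀ f : ℂ → ℂ, IsAdmissible n σ τ z f →
      ∃ C : ℂ, ∀ u : ℂ, f u =
        C * pairingSum n (numeratorExp σ τ) (prefactorExp σ τ) (prepend u z)) := by
  obtain ⟨β₁, β₂, a, b, hω, D⟩ := exists_thetaPair_of_isReal hσ hτ
  obtain ⟨G, hG, hG0, h⟩ := D.holdsGenerically hn
  refine ⟨G, hG, hG0, fun z hz f hf => h z hz f (hf.isTheta hn) ?_ hf.zero fun j => ?_⟩
  · have h3 := hf.three_term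
    intro u
    cases σ <;> first | exact h3 u | exact hσ.elim
  · rw [← hω]; exact hf.zero_half j

theorem ThreeTerm.modularTransform {n : ℕ} (hn : 0 < n) {σ : Label} (hσ : ¬ σ.IsReal) {τ S : ℂ}
    {f : ℂ → ℂ} (h : ThreeTerm n σ τ (exp (2 * Real.pi * I * S)) f) :
    ThreeTermThird (modularTransform τ (3 * (2 * n - 1 : ℕ)) (3 * S) f) := by
  have hn' : ((2 * n - 1 : ℕ) : ℂ) = 2 * n - 1 := by
    rw [Nat.cast_sub (by omega)]; push_cast; ring
  have h' : ∀ u : ℂ, exp (2 * Real.pi * I * S) ^ 2 *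
      exp (-((8 * n - 4) * Real.pi * I * u)) * f (u - 2 * τ / 3) +
        exp (-((8 * n - 4) * Real.pi * I * τ / 3)) * f u +
        (exp (2 * Real.pi * I * S) ^ 2)⁻¹ * exp ((8 * n - 4) * Real.pi * I * u) *
          f (u + 2 * τ / 3) = 0 := by
    intro u
    cases σ <;> first | exact h u | exact absurd trivial hσ
  intro w
  have h1 := h' (τ * w)
  rw [← exp_nat_mul, ← exp_neg, ← exp_add, ← exp_add] at h1
  rw [EllipticPfaffian.modularTransform, EllipticPfaffian.modularTransform,
    EllipticPfaffian.modularTransform, hn',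
    show τ * (w - 2 / 3) = τ * w - 2 * τ / 3 by ring,
    show τ * (w + 2 / 3) = τ * w + 2 * τ / 3 by ring]
  have e : ∀ x y : ℂ, exp x = exp (Real.pi * I * (τ * (3 * (2 * n - 1)) * w ^ 2 - 2 * (3 * S) * w) +
      (8 * n - 4) * Real.pi * I * τ / 3) * exp y ↔ exp x = exp (
        Real.pi * I * (τ * (3 * (2 * n - 1)) * w ^ 2 - 2 * (3 * S) * w) +
      (8 * n - 4) * Real.pi * I * τ / 3 + y) := fun x y => by rw [exp_add _ y]
  rw [(e (Real.pi * I * (τ * (3 * (2 * n - 1)) * (w - 2 / 3) ^ 2 - 2 * (3 * S) * (w - 2 / 3)))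
      ((2 : ℕ) * (2 * Real.pi * I * S) + -((8 * n - 4) * Real.pi * I * (τ * w)))).2
      (by congr 1; push_cast; ring),
    (e (Real.pi * I * (τ * (3 * (2 * n - 1)) * (w + 2 / 3) ^ 2 - 2 * (3 * S) * (w + 2 / 3)))
      (-((2 : ℕ) * (2 * Real.pi * I * S)) + (8 * n - 4) * Real.pi * I * (τ * w))).2
      (by congr 1; push_cast; ring),
    (e (Real.pi * I * (τ * (3 * (2 * n - 1)) * w ^ 2 - 2 * (3 * S) * w))
      (-((8 * n - 4) * Real.pi * I * τ / 3))).2 (by congr 1; ring)]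
  linear_combination exp (Real.pi * I * (τ * (3 * (2 * n - 1)) * w ^ 2 - 2 * (3 * S) * w) +
      (8 * n - 4) * Real.pi * I * τ / 3) * h1

theorem holdsGenerically_of_not_isReal {n : ℕ} (hn : 0 < n) {σ : Label} (hσ : ¬ σ.IsReal) {τ : ℂ}
    (hτ : 0 < τ.im) :
    HoldsGenerically (fun z : Fin (2 * n - 1) → ℂ => ∀ f : ℂ → ℂ, IsAdmissible n σ τ z f →
      ∃ C : ℂ, ∀ u : ℂ, f u =
        C * pairingSum n (numeratorExp σ τ) (prefactorExp σ τ) (prepend u z)) := by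
  have hτ0 : τ ≠ 0 := fun h => by simp [h] at hτ
  obtain ⟨β₁, β₂, a, b, hω, D⟩ := exists_thetaPair_of_not_isReal hσ hτ
  obtain ⟨G, hG, ⟨x, hx⟩, h⟩ := D.holdsGenerically hn
  refine ⟨fun z => G (fun i => z i / τ), hG.comp (by fun_prop), ⟨fun i => τ * x i, ?_⟩,
    fun z hz f hf => ?_⟩
  · simpa [mul_div_cancel_left₀ _ hτ0] using hx
  have hS : 3 * ∑ i, z i / τ = 3 * (∑ i, z i) / τ := by rw [← Finset.sum_div, mul_div_assoc]
  have hzero : ∀ v, f (τ * v) = 0 →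
      modularTransform τ (3 * (2 * n - 1 : ℕ)) (3 * ∑ i, z i) f v = 0 := fun v hv => by
    rw [modularTransform, hv, mul_zero]
  obtain ⟨C, hC⟩ := h _ hz (modularTransform τ (3 * (2 * n - 1 : ℕ)) (3 * ∑ i, z i) f)
    (hS ▸ (hf.isTheta hn).modularTransform hτ0 (periodSign_eq σ))
    (hf.three_term.modularTransform hn hσ)
    (fun j => hzero _ (by rw [mul_div_cancel₀ _ hτ0]; exact hf.zero j))
    (fun j => hzero _ (by
      rw [← hω, mul_add, mul_div_cancel₀ _ hτ0, mul_div_cancel₀ _ hτ0]; exact hf.zero_half j))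
  obtain ⟨κ, hκ⟩ := exists_sum_lt_prepend_eq hn (fun i => z i / τ)
  refine ⟨C * exp (3 * Real.pi * I * τ * κ), fun u => ?_⟩
  have hCu := hC (u / τ)
  have hpre : (fun i => τ * prepend (u / τ) (fun i => z i / τ) i) = prepend u z := by
    funext i
    by_cases hi : i.val = 0 <;> simp [prepend, hi, mul_div_cancel₀ _ hτ0]
  rw [pairingSum_modularTransform, hpre, hκ, modularTransform, mul_div_cancel₀ _ hτ0,
    ← Finset.sum_div,
    show 3 * Real.pi * I * τ * ((2 * n - 1 : ℕ) * (u / τ) ^ 2 - 2 * ((∑ i, z i) / τ) * (u / τ) + κ)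
      = Real.pi * I * (τ * (3 * (2 * n - 1 : ℕ)) * (u / τ) ^ 2 - 2 * (3 * ∑ i, z i) * (u / τ)) +
        3 * Real.pi * I * τ * κ by field_simp, exp_add] at hCu
  refine mul_left_cancel₀ (exp_ne_zero (Real.pi * I *
    (τ * (3 * (2 * n - 1 : ℕ)) * (u / τ) ^ 2 - 2 * (3 * ∑ i, z i) * (u / τ)))) ?_
  rw [hCu]; ring

end EllipticPfaffian

theorem mainTheorem4 (n : ℕ) (hn : 0 < n) (σ : EllipticPfaffian.Label) (τ : ℂ) (hτ : 0 < τ.im) :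
    EllipticPfaffian.HoldsGenerically (fun z : Fin (2 * n - 1) → ℂ =>
      ∀ f : ℂ → ℂ, EllipticPfaffian.IsAdmissible n σ τ z f →
        ∃ C : ℂ, ∀ u : ℂ, f u = C * EllipticPfaffian.P n σ (EllipticPfaffian.prepend u z) τ) := by
  obtain ⟨G, hG, hG0, h⟩ := (em σ.IsReal).elim
    (fun hσ => EllipticPfaffian.holdsGenerically_of_isReal hn hσ hτ)
    (fun hσ => EllipticPfaffian.holdsGenerically_of_not_isReal hn hσ hτ)
  refine ⟨G, hG, hG0, fun z hz f hf => ?_⟩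
  obtain ⟨C, hC⟩ := h z hz f hf
  refine ⟨C * (2 ^ n * (n.factorial : ℂ)), fun u => ?_⟩
  have hfac : (2 ^ n * (n.factorial : ℂ)) ≠ 0 :=
    mul_ne_zero (pow_ne_zero _ two_ne_zero) (Nat.cast_ne_zero.2 n.factorial_ne_zero)
  rw [hC, EllipticPfaffian.P_eq_pairingSum, mul_assoc C, ← mul_assoc (2 ^ n * _ : ℂ),
    mul_one_div_cancel hfac, one_mul]
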